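/- Fix a prime $p$. For all non-negative integers $a, e, c$ there exists a positive integer $n = n(a,e,c)$, depending only on $a$, $e$ and $c$ (for the fixed prime $p$), such that the following holds. Let $R$ be a (commutative) $\mathbb{Z}/p^a$-algebra, let $\mathcal{P}$ and $\mathcal{P}'$ be nilpotent displays over $R$ of nilpotence order less or equal than $e$, where $\mathcal{P}$ has codimension $c$, and let $f \colon \mathcal{P} \to \mathcal{P}'$ be a morphism of displays. Then the following conditions are equivalent: 1. The morphism $f \colon \mathcal{P} \to \mathcal{P}'$ is divisible by $p$, i.e. $f = p \cdot g$ for some morphism of displays $g \colon \mathcal{P} \to \mathcal{P}'$. 2. The truncated morphism $f[n] \colon \mathcal{P}[n] \to \mathcal{P}'[n]$ is divisible by $p$, i.e. $f[n] = p \cdot g_n$ for some morphism of $n$-truncated displays $g_n \colon \mathcal{P}[n] \to \mathcal{P}'[n]$. Here a display over $R$ is a pair $(T, L)$ of finite projective modules over the ring $W(R)$ of $p$-typical Witt vectors together with a $W(R)$-linear isomorphism $\Psi \colon T^F \oplus L^F \to T \oplus L$, where $(-)^F$ denotes base change along the Frobenius $F$. With $I_R = \ker(W(R) \to R)$ and $F^{\mathrm{div}}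 \colon I_R \to W(R)$ the inverse of the Verschiebung, a morphism $(T, L, \Psi) \to (T', L', \Psi')$ is a matrix $\begin{bmatrix} \alpha & \beta \\ \gamma & \delta \end{bmatrix}$ of $W(R)$-linear maps $\alpha \colon T \to T'$, $\beta \colon L \to I_R \otimes T'$, $\gamma \colon T \to L'$, $\delta \colon L \to L'$ with $$\begin{bmatrix} \alpha & \beta \\ \gamma & \delta \end{bmatrix} \circ \Psi = \Psi' \circ \begin{bmatrix} \alpha^F & \beta^{F, \mathrm{div}} \\ p \cdot \gamma^F & \delta^F \end{bmatrix},$$ where on the left $\beta$ is composed with $I_R \otimes T' \to T'$, and $\beta^{F,\mathrm{div}} \colon L^F \to (T')^F$ is induced by $\beta$ and $F^{\mathrm{div}}$. An $n$-truncated display and its morphisms are defined in the same way: $(T, L)$ and the entries of matrices live over $\mathcal{W}_n(R) = W_{n+1}(R)/(0, \dotsc, 0, R[p])$, with $R[p]$ the $p$-torsion of $R$; the ideal $I_R$ is replaced by $I_{n+1,R} = \ker(W_{n+1}(R) \to R)$; and $\Psi$ is an isomorphism of $W_n(R)$-modules, formed with $F \colon \mathcal{W}_n(R) \to W_n(R)$,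 $F^{\mathrm{div}} \colon I_{n+1,R} \to W_n(R)$ and the projection $\mathcal{W}_n(R) \to W_n(R)$. The truncation $(-)[n]$ is the base change along $W(R) \to \mathcal{W}_n(R)$, $W(R) \to W_n(R)$. The codimension of $(T, L)$ is the (constant) rank of $L$. The display has nilpotence order less or equal than $e$ if, writing $N = (R/pR) \otimes_{W(R)} L$ and $z \colon N \to N^{(p)}$ for the reduction of the component $L \to L^F$ of $\Psi^{-1}$, the composition $z^{(p^{e-1})} \circ \dotsb \circ z^{(p)} \circ z \colon N \to N^{(p^e)}$ vanishes. -/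

import Mathlib

open scoped TensorProduct

universe u

noncomputable section

namespace Displays

/-! ### Base change of modules along a ring homomorphism

A frame comes with two different ring homomorphisms between the same two rings, so that base change
is written with an explicit ring homomorphism instead of an `Algebra` instance. -/

section BaseChange

variable {A : Type u} {B : Type u} {C : Type u} {D : Type u}
  [CommRing A] [CommRing B] [CommRing C] [CommRing D]

/-- The ring `B`, regarded as an `A`-algebra through `f : A → B`. -/
def Over (_ : A →+* B) : Type u := B

instance (f : A →+* B) : CommRing (Over f) := inferInstanceAs (CommRing B)

instance (f : A →+* B) : Algebra A (Over f) := f.toAlgebra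

/-- The base change `B ⊗_{f, A} M` of an `A`-module `M` along `f : A → B`. -/
def BC (f : A →+* B) (M : Type u) [AddCommGroup M] [Module A M] : Type u :=
  Over f ⊗[A] M

namespace BC

variable (f : A →+* B)
variable (M : Type u) [AddCommGroup M] [Module A M]
variable (N : Type u) [AddCommGroup N] [Module A N]

instance : AddCommGroup (BC f M) :=
  inferInstanceAs (AddCommGroup (Over f ⊗[A] M))

instance : Module B (BC f M) :=
  inferInstanceAs (Module (Over f) (Over f ⊗[A] M))

instance [Module.Finite A M] : Module.Finite B (BC f M) :=
  inferInstanceAs (Module.Finite (Over f) (Over f ⊗[A] M))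

instance [Module.Projective A M] : Module.Projective B (BC f M) :=
  inferInstanceAs (Module.Projective (Over f) (Over f ⊗[A] M))

variable {M N}

/-- The canonical `f`-linear map `m ↦ 1 ⊗ m`. -/
def of : M →ₛₗ[f] BC f M where
  toFun m := (1 : Over f) ⊗ₜ[A] m
  map_add' x y := TensorProduct.tmul_add _ _ _
  map_smul' a m := by
    change (1 : Over f) ⊗ₜ[A] (a • m) = (algebraMap A (Over f) a) • ((1 : Over f) ⊗ₜ[A] m)
    rw [← TensorProduct.smul_tmul, TensorProduct.smul_tmul', Algebra.smul_def, smul_eq_mul]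

theorem induction {motive : BC f M → Prop} (zero : motive 0)
    (smul_of : ∀ (b : B) (m : M), motive (b • of f m))
    (add : ∀ x y, motive x → motive y → motive (x + y)) (x : BC f M) : motive x := by
  refine TensorProduct.induction_on (motive := motive) x zero (fun b m => ?_) add
  have h : (b ⊗ₜ[A] m : Over f ⊗[A] M) = b • ((1 : Over f) ⊗ₜ[A] m) := by
    rw [TensorProduct.smul_tmul', smul_eq_mul, mul_one]
  rw [h]
  exact smul_of b m

variable {f}

/-- The additive map underlying `lift`. -/
def liftAux (g : B →+* C) {h : A →+* C} [RingHomCompTriple f g h]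
    {P : Type u} [AddCommGroup P] [Module C P] (φ : M →ₛₗ[h] P) : Over f ⊗[A] M →+ P :=
  let g₁ : Over f →+* C := g
  TensorProduct.liftAddHom
    { toFun := fun b =>
        { toFun := fun m => g₁ b • φ m
          map_zero' := by simp
          map_add' := fun x y => by simp }
      map_zero' := by ext; simp
      map_add' := fun x y => by ext; simp [add_smul] }
    (fun a b m => by
      change g₁ (a • b) • φ m = g₁ b • φ (a • m)
      have h1 : g₁ (algebraMap A (Over f) a) = h a :=
        RingHomCompTriple.comp_apply (σ₁₂ := f) (σ₂₃ := g) (σ₁₃ := h)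
      rw [φ.map_smulₛₗ, Algebra.smul_def, map_mul, smul_smul, mul_comm, h1])

/-- For `h = g ∘ f`, an `h`-linear map `M → P` extends uniquely to a `g`-linear map
`B ⊗_{f, A} M → P`, given by `b ⊗ m ↦ g b • φ m`. -/
def lift {g : B →+* C} {h : A →+* C} [RingHomCompTriple f g h]
    {P : Type u} [AddCommGroup P] [Module C P] (φ : M →ₛₗ[h] P) : BC f M →ₛₗ[g] P where
  toFun := liftAux g φ
  map_add' := (liftAux g φ).map_add
  map_smul' b x := by
    let g₁ : Over f →+* C := g
    let b₁ : Over f := b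
    change liftAux g φ (b₁ • (show Over f ⊗[A] M from x)) =
      g₁ b₁ • liftAux g φ (show Over f ⊗[A] M from x)
    induction (show Over f ⊗[A] M from x) using TensorProduct.induction_on with
    | zero => simp
    | tmul c m =>
      change g₁ (b₁ * c) • φ m = g₁ b₁ • (g₁ c • φ m)
      rw [map_mul, mul_smul]
    | add x y hx hy => rw [smul_add, map_add, map_add, smul_add, hx, hy]

@[simp]
theorem lift_of {g : B →+* C} {h : A →+* C} [RingHomCompTriple f g h]
    {P : Type u} [AddCommGroup P] [Module C P] (φ : M →ₛₗ[h] P) (m : M) :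
    lift (f := f) (g := g) φ (of f m) = φ m := by
  change g 1 • φ m = φ m
  rw [map_one, one_smul]

theorem hom_ext {g : B →+* C} {P : Type u} [AddCommGroup P] [Module C P]
    {φ ψ : BC f M →ₛₗ[g] P} (H : ∀ m, φ (of f m) = ψ (of f m)) : φ = ψ := by
  ext x
  induction x using BC.induction with
  | zero => simp
  | smul_of b m => rw [map_smulₛₗ, map_smulₛₗ, H]
  | add x y hx hy => rw [map_add, map_add, hx, hy]

theorem hom_ext₂ {g : B →+* C} {P : Type u} [AddCommGroup P] [Module C P]
    {φ ψ : BC g (BC f M) →ₗ[C] P} (H : ∀ m, φ (of g (of f m)) = ψ (of g (of f m))) : φ = ψ := by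
  refine hom_ext fun x => ?_
  induction x using BC.induction with
  | zero => simp
  | smul_of b m => rw [map_smulₛₗ, map_smul, map_smul, H]
  | add x y hx hy => rw [map_add, map_add, map_add, hx, hy]

variable (f)

/-- The base change of a linear map. -/
def map (φ : M →ₗ[A] N) : BC f M →ₗ[B] BC f N :=
  lift (f := f) (g := RingHom.id B) (h := f) ((of f).comp φ)

@[simp]
theorem map_of (φ : M →ₗ[A] N) (m : M) : map f φ (of f m) = of f (φ m) :=
  lift_of _ _

/-- The base change of a linear isomorphism. -/
def congr (φ : M ≃ₗ[A] N) : BC f M ≃ₗ[B] BC f N :=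
  LinearEquiv.ofLinearMap (map f φ.toLinearMap) (map f φ.symm.toLinearMap)
    (hom_ext fun m => by simp) (hom_ext fun m => by simp)

@[simp]
theorem congr_of (φ : M ≃ₗ[A] N) (m : M) : congr f φ (of f m) = of f (φ m) :=
  map_of f φ.toLinearMap m

/-- Base change commutes with direct sums. -/
def prodEquiv : BC f (M × N) ≃ₗ[B] BC f M × BC f N :=
  LinearEquiv.ofLinearMap
    ((map f (LinearMap.fst A M N)).prod (map f (LinearMap.snd A M N)))
    ((map f (LinearMap.inl A M N)).coprod (map f (LinearMap.inr A M N)))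
    (LinearMap.prod_ext (hom_ext fun m => by simp) (hom_ext fun m => by simp))
    (hom_ext fun m => by simp [← map_add])

@[simp]
theorem prodEquiv_of (m : M × N) : prodEquiv f (of f m) = (of f m.1, of f m.2) := by
  simp [prodEquiv]

@[simp]
theorem prodEquiv_symm_of (m : M) (n : N) :
    (prodEquiv f).symm (of f m, of f n) = of f (m, n) := by
  rw [LinearEquiv.symm_apply_eq, prodEquiv_of]

@[simp]
theorem prodEquiv_symm_left (m : M) :
    (prodEquiv (N := N) f).symm (of f m, 0) = of f (m, 0) := by
  rw [LinearEquiv.symm_apply_eq, prodEquiv_of, map_zero]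

@[simp]
theorem prodEquiv_symm_right (n : N) :
    (prodEquiv (M := M) f).symm (0, of f n) = of f (0, n) := by
  rw [LinearEquiv.symm_apply_eq, prodEquiv_of, map_zero]

/-- Transitivity of base change: `C ⊗_{g, B} (B ⊗_{f, A} M) = C ⊗_{h, A} M` for `h = g ∘ f`. -/
def compEquiv (g : B →+* C) (h : A →+* C) (hh : g.comp f = h) (M : Type u) [AddCommGroup M]
    [Module A M] : BC g (BC f M) ≃ₗ[C] BC h M :=
  haveI : RingHomCompTriple f g h := ⟨hh⟩
  LinearEquiv.ofLinearMap
    (lift (f := g) (g := RingHom.id C) (h := g)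
      (lift (f := f) (g := g) (h := h) (of h)))
    (lift (f := h) (g := RingHom.id C) (h := h) ((of g).comp (of f)))
    (hom_ext fun m => by simp)
    (hom_ext fun x => by
      induction x using BC.induction with
      | zero => simp
      | smul_of b m => simp [map_smulₛₗ]
      | add x y hx hy => rw [map_add, map_add, map_add, hx, hy])

@[simp]
theorem compEquiv_of (g : B →+* C) (h : A →+* C) (hh : g.comp f = h) (m : M) :
    compEquiv f g h hh M (of g (of f m)) = of h m := by
  simp [compEquiv]

@[simp]
theorem compEquiv_symm_of (g : B →+* C) (h : A →+* C) (hh : g.comp f = h) (m : M) :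
    (compEquiv f g h hh M).symm (of h m) = of g (of f m) := by
  rw [LinearEquiv.symm_apply_eq, compEquiv_of]

/-- Base change along the two sides of a commutative square of rings `g ∘ f = l ∘ k`. -/
def swap (g : B →+* D) (k : A →+* C) (l : C →+* D) (hh : g.comp f = l.comp k)
    (M : Type u) [AddCommGroup M] [Module A M] : BC g (BC f M) ≃ₗ[D] BC l (BC k M) :=
  (compEquiv f g (l.comp k) hh M).trans (compEquiv k l (l.comp k) rfl M).symm

@[simp]
theorem swap_of (g : B →+* D) (k : A →+* C) (l : C →+* D) (hh : g.comp f = l.comp k) (m : M) :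
    swap f g k l hh M (of g (of f m)) = of l (of k m) := by
  simp [swap]

end BC

end BaseChange

/-! ### Frames and windows -/

/-- A frame `(𝒮, ℐ, S, σ, σ^div)`: a ring with filtration `(𝒮, ℐ)`, a quotient `S` of `𝒮`,
a ring homomorphism `σ : 𝒮 → S` and a `σ`-linear map `σ^div : ℐ → S` with `p σ^div(x) = σ(x)`. -/
structure Frame (p : ℕ) where
  /-- the ring `𝒮` -/
  A : Type u
  /-- the module `ℐ` -/
  I : Type u
  /-- the quotient `S` of `𝒮` -/
  S : Type u
  [ringA : CommRing A]
  [groupI : AddCommGroup I]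
  [moduleI : Module A I]
  [ringS : CommRing S]
  /-- the structure map `ℐ → 𝒮` -/
  incl : I →ₗ[A] A
  incl_mem_jacobson : ∀ x, incl x ∈ Ideal.jacobson (⊥ : Ideal A)
  /-- the projection `𝒮 → S` -/
  proj : A →+* S
  proj_surjective : Function.Surjective proj
  /-- the Frobenius `σ : 𝒮 → S` -/
  sigma : A →+* S
  /-- the divided Frobenius `σ^div : ℐ → S` -/
  sigmaDiv : I →ₛₗ[sigma] S
  p_mul_sigmaDiv : ∀ x, (p : S) * sigmaDiv x = sigma (incl x)

attribute [instance] Frame.ringA Frame.groupI Frame.moduleI Frame.ringS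

/-- A finite projective `(𝒮, ℐ)`-module `(T, L)`. -/
structure FilMod {p : ℕ} (F : Frame.{u} p) where
  T : Type u
  L : Type u
  [groupT : AddCommGroup T]
  [moduleT : Module F.A T]
  [groupL : AddCommGroup L]
  [moduleL : Module F.A L]
  [finiteT : Module.Finite F.A T]
  [projectiveT : Module.Projective F.A T]
  [finiteL : Module.Finite F.A L]
  [projectiveL : Module.Projective F.A L]

attribute [instance] FilMod.groupT FilMod.moduleT FilMod.groupL FilMod.moduleL
  FilMod.finiteT FilMod.projectiveT FilMod.finiteL FilMod.projectiveL

section Windows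

variable {p : ℕ} {F G : Frame.{u} p}

/-- A homomorphism `(T, L) → (T', L')` of finite projective `(𝒮, ℐ)`-modules: a matrix with entries
`a : T → T'`, `b : L → ℐ ⊗ T'`, `c : T → L'`, `d : L → L'`. -/
@[ext]
structure FilMod.Hom (P Q : FilMod F) where
  a : P.T →ₗ[F.A] Q.T
  b : P.L →ₗ[F.A] F.I ⊗[F.A] Q.T
  c : P.T →ₗ[F.A] Q.L
  d : P.L →ₗ[F.A] Q.L

/-- Multiples of a homomorphism are formed entrywise. -/
instance (P Q : FilMod F) : SMul ℕ (FilMod.Hom P Q) :=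
  ⟨fun n f => ⟨n • f.a, n • f.b, n • f.c, n • f.d⟩⟩

namespace FilMod

/-- The `S`-module `S ⊗_{(𝒮, ℐ)} P = S ⊗ (T ⊕ L)`. -/
abbrev Under (P : FilMod F) : Type u := BC F.proj P.T × BC F.proj P.L

/-- The Frobenius-twisted modification `P^σ = T^σ ⊕ L^σ`. -/
abbrev Twist (P : FilMod F) : Type u := BC F.sigma P.T × BC F.sigma P.L

/-- For `b : M → ℐ ⊗ N`, the composition `M → ℐ ⊗ N → N`. -/
def bIncl {M N : Type u} [AddCommGroup M] [Module F.A M] [AddCommGroup N] [Module F.A N]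
    (b : M →ₗ[F.A] F.I ⊗[F.A] N) : M →ₗ[F.A] N :=
  (TensorProduct.lift ((LinearMap.lsmul F.A N).comp F.incl)).comp b

/-- The `σ`-linear map `ℐ ⊗ N → N^σ`, `x ⊗ n ↦ σ^div(x) (1 ⊗ n)`. -/
def divMap (F : Frame.{u} p) (N : Type u) [AddCommGroup N] [Module F.A N] :
    F.I ⊗[F.A] N →ₛₗ[F.sigma] BC F.sigma N :=
  TensorProduct.lift (LinearMap.mk₂'ₛₗ F.sigma F.sigma
    (fun x n => F.sigmaDiv x • BC.of F.sigma n)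
    (fun x y n => by rw [map_add, add_smul])
    (fun s x n => by rw [map_smulₛₗ, smul_assoc])
    (fun x m n => by rw [map_add, smul_add])
    (fun s x n => by rw [map_smulₛₗ, smul_comm]))

/-- For `b : M → ℐ ⊗ N`, the composition `b^{σ, div} : M^σ → ℐ^σ ⊗ N^σ → N^σ`. -/
def bDiv {M N : Type u} [AddCommGroup M] [Module F.A M] [AddCommGroup N] [Module F.A N]
    (b : M →ₗ[F.A] F.I ⊗[F.A] N) : BC F.sigma M →ₗ[F.S] BC F.sigma N :=
  (BC.lift (f := F.sigma) (g := RingHom.id F.S) (divMap F N)).comp (BC.map F.sigma b)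

/-- The `S`-linear map induced on `S ⊗_{(𝒮, ℐ)} P`, with matrix `[a, b; c, d]`. -/
def Hom.under {P Q : FilMod F} (f : Hom P Q) : P.Under →ₗ[F.S] Q.Under :=
  ((BC.map F.proj f.a).coprod (BC.map F.proj (bIncl f.b))).prod
    ((BC.map F.proj f.c).coprod (BC.map F.proj f.d))

/-- The `S`-linear map induced on `P^σ`, with matrix `[a^σ, b^{σ, div}; p c^σ, d^σ]`. -/
def Hom.twist {P Q : FilMod F} (f : Hom P Q) : P.Twist →ₗ[F.S] Q.Twist :=
  ((BC.map F.sigma f.a).coprod (bDiv f.b)).prod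
    ((p • BC.map F.sigma f.c).coprod (BC.map F.sigma f.d))

end FilMod

/-- `P = (T, L)` has codimension `c`: the finite projective `𝒮`-module `L` has constant rank `c`. -/
def FilMod.HasCodim (P : FilMod F) (c : ℕ) : Prop :=
  ∀ q : PrimeSpectrum F.A, Module.rankAtStalk (R := F.A) P.L q = c

/-- A window over a frame: a finite projective `(𝒮, ℐ)`-module `P` with an isomorphism of
`S`-modules `Ψ : P^σ → S ⊗_{(𝒮, ℐ)} P`. -/
structure Window (F : Frame.{u} p) extends FilMod F where
  Psi : toFilMod.Twist ≃ₗ[F.S] toFilMod.Under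

/-- The component `S ⊗ L → L^σ` of `Ψ⁻¹ : S ⊗ (T ⊕ L) → T^σ ⊕ L^σ`. -/
def Window.zBreve (P : Window F) : BC F.proj P.L →ₗ[F.S] BC F.sigma P.L :=
  LinearMap.snd _ _ _ ∘ₗ P.Psi.symm.toLinearMap ∘ₗ LinearMap.inr _ _ _

/-- The base change of `Window.zBreve` along `κS : S → k`, where `k` is a ring with an endomorphism
`φ` that is compatible with `σ`. It is a map `N → N^φ` with `N = k ⊗_𝒮 L`. -/
def Window.zBar (P : Window F) {k : Type u} [CommRing k] (κ : F.A →+* k) (κS : F.S →+* k)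
    (hκ : κS.comp F.proj = κ) (φ : k →+* k) (hφ : κS.comp F.sigma = φ.comp κ) :
    BC κ P.L →ₗ[k] BC φ (BC κ P.L) :=
  (BC.swap F.sigma κS κ φ hφ P.L).toLinearMap ∘ₗ BC.map κS P.zBreve ∘ₗ
    (BC.compEquiv F.proj κS κ hκ P.L).symm.toLinearMap

/-- A morphism of windows: a homomorphism of the underlying `(𝒮, ℐ)`-modules that is compatible
with the isomorphisms `Ψ`. -/
structure Window.Hom (P Q : Window F) extends FilMod.Hom P.toFilMod Q.toFilMod where
  comm : ∀ x, toHom.under (P.Psi x) = Q.Psi (toHom.twist x)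

/-- `f` is divisible by `m` in the group of morphisms `P → Q`: there is a morphism of windows
`g : P → Q` with `f = m • g`. -/
def Window.Hom.DivisibleBy {P Q : Window F} (f : Window.Hom P Q) (m : ℕ) : Prop :=
  ∃ g : Window.Hom P Q, f.toHom = m • g.toHom

/-! ### Base change of windows along a homomorphism of frames -/

/-- A homomorphism of frames. -/
structure FrameHom (F G : Frame.{u} p) where
  onA : F.A →+* G.A
  onS : F.S →+* G.S
  onI : F.I →ₛₗ[onA] G.I
  incl_comm : ∀ x, G.incl (onI x) = onA (F.incl x)
  proj_comm : G.proj.comp onA = onS.comp F.proj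
  sigma_comm : G.sigma.comp onA = onS.comp F.sigma
  sigmaDiv_comm : ∀ x, G.sigmaDiv (onI x) = onS (F.sigmaDiv x)

/-- The base change `(𝒮' ⊗ T, 𝒮' ⊗ L)` of `(T, L)`. -/
abbrev FilMod.baseChange (α : FrameHom F G) (P : FilMod F) : FilMod G where
  T := BC α.onA P.T
  L := BC α.onA P.L

/-- The canonical map `ℐ ⊗_𝒮 N → ℐ' ⊗_{𝒮'} (𝒮' ⊗_𝒮 N)`. -/
def FrameHom.onTensor (α : FrameHom F G) (N : Type u) [AddCommGroup N] [Module F.A N] :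
    F.I ⊗[F.A] N →ₛₗ[α.onA] G.I ⊗[G.A] BC α.onA N :=
  TensorProduct.map α.onI (BC.of α.onA)

/-- The base change of a homomorphism, entry by entry. -/
def FilMod.Hom.baseChange (α : FrameHom F G) {P Q : FilMod F} (f : FilMod.Hom P Q) :
    FilMod.Hom (P.baseChange α) (Q.baseChange α) where
  a := BC.map α.onA f.a
  b := BC.lift (f := α.onA) (g := RingHom.id G.A) (h := α.onA) ((α.onTensor Q.T).comp f.b)
  c := BC.map α.onA f.c
  d := BC.map α.onA f.d

/-- `(𝒮' ⊗ P)^σ = S' ⊗_S P^σ`. -/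
def FilMod.twistEquiv (α : FrameHom F G) (P : FilMod F) :
    (P.baseChange α).Twist ≃ₗ[G.S] BC α.onS P.Twist :=
  (LinearEquiv.prodCongr
    (BC.swap α.onA G.sigma F.sigma α.onS α.sigma_comm P.T)
    (BC.swap α.onA G.sigma F.sigma α.onS α.sigma_comm P.L)).trans (BC.prodEquiv α.onS).symm

/-- `S' ⊗_{(𝒮', ℐ')} (𝒮' ⊗ P) = S' ⊗_S (S ⊗_{(𝒮, ℐ)} P)`. -/
def FilMod.underEquiv (α : FrameHom F G) (P : FilMod F) :
    (P.baseChange α).Under ≃ₗ[G.S] BC α.onS P.Under :=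
  (LinearEquiv.prodCongr
    (BC.swap α.onA G.proj F.proj α.onS α.proj_comm P.T)
    (BC.swap α.onA G.proj F.proj α.onS α.proj_comm P.L)).trans (BC.prodEquiv α.onS).symm

/-- The base change of a window. -/
abbrev Window.baseChange (α : FrameHom F G) (P : Window F) : Window G where
  toFilMod := P.toFilMod.baseChange α
  Psi := (P.toFilMod.twistEquiv α).trans
    ((BC.congr α.onS P.Psi).trans (P.toFilMod.underEquiv α).symm)

theorem FilMod.bIncl_baseChange (α : FrameHom F G) {N : Type u}
    [AddCommGroup N] [Module F.A N] (x : F.I ⊗[F.A] N) :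
    TensorProduct.lift ((LinearMap.lsmul G.A (BC α.onA N)).comp G.incl) (α.onTensor N x) =
      BC.of α.onA (TensorProduct.lift ((LinearMap.lsmul F.A N).comp F.incl) x) := by
  induction x using TensorProduct.induction_on with
  | zero => simp
  | tmul i n => simp [FrameHom.onTensor, α.incl_comm, map_smulₛₗ]
  | add x y hx hy => simp only [map_add, hx, hy]

theorem FilMod.divMap_baseChange (α : FrameHom F G) {N : Type u}
    [AddCommGroup N] [Module F.A N] (x : F.I ⊗[F.A] N) :
    BC.swap α.onA G.sigma F.sigma α.onS α.sigma_comm N (divMap G (BC α.onA N) (α.onTensor N x)) =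
      BC.of α.onS (divMap F N x) := by
  induction x using TensorProduct.induction_on with
  | zero => simp
  | tmul i n => simp [FrameHom.onTensor, divMap, α.sigmaDiv_comm, map_smulₛₗ]
  | add x y hx hy => simp only [map_add, hx, hy]

theorem FilMod.twistEquiv_twist (α : FrameHom F G) {P Q : FilMod F} (f : FilMod.Hom P Q)
    (x : (P.baseChange α).Twist) :
    Q.twistEquiv α ((f.baseChange α).twist x) = BC.map α.onS f.twist (P.twistEquiv α x) := by
  have h : (Q.twistEquiv α).toLinearMap ∘ₗ (f.baseChange α).twist =
      BC.map α.onS f.twist ∘ₗ (P.twistEquiv α).toLinearMap := by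
    refine LinearMap.prod_ext (BC.hom_ext₂ fun m => ?_) (BC.hom_ext₂ fun m => ?_)
    · simp [FilMod.twistEquiv, FilMod.Hom.baseChange, FilMod.Hom.twist]
      rw [← map_nsmul, BC.prodEquiv_symm_of]
    · have hb := FilMod.divMap_baseChange α (f.b m)
      simp [FilMod.twistEquiv, FilMod.Hom.baseChange, FilMod.Hom.twist, FilMod.bDiv, hb]
  exact LinearMap.congr_fun h x

theorem FilMod.underEquiv_under (α : FrameHom F G) {P Q : FilMod F} (f : FilMod.Hom P Q)
    (x : (P.baseChange α).Under) :
    Q.underEquiv α ((f.baseChange α).under x) = BC.map α.onS f.under (P.underEquiv α x) := by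
  have h : (Q.underEquiv α).toLinearMap ∘ₗ (f.baseChange α).under =
      BC.map α.onS f.under ∘ₗ (P.underEquiv α).toLinearMap := by
    refine LinearMap.prod_ext (BC.hom_ext₂ fun m => ?_) (BC.hom_ext₂ fun m => ?_)
    · simp [FilMod.underEquiv, FilMod.Hom.baseChange, FilMod.Hom.under]
    · have hb := FilMod.bIncl_baseChange α (f.b m)
      simp [FilMod.underEquiv, FilMod.Hom.baseChange, FilMod.Hom.under, FilMod.bIncl, hb]
  exact LinearMap.congr_fun h x

/-- The base change of a morphism of windows. -/
def Window.Hom.baseChange (α : FrameHom F G) {P Q : Window F} (f : Window.Hom P Q) :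
    Window.Hom (P.baseChange α) (Q.baseChange α) where
  toHom := f.toHom.baseChange α
  comm x := by
    have key : ∀ y : BC α.onS P.Twist,
        BC.map α.onS f.under (BC.congr α.onS P.Psi y) =
          BC.congr α.onS Q.Psi (BC.map α.onS f.twist y) := by
      intro y
      have h : BC.map α.onS f.under ∘ₗ (BC.congr α.onS P.Psi).toLinearMap =
          (BC.congr α.onS Q.Psi).toLinearMap ∘ₗ BC.map α.onS f.twist :=
        BC.hom_ext fun m => by simp [f.comm]
      exact LinearMap.congr_fun h y
    apply (Q.toFilMod.underEquiv α).injective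
    rw [FilMod.underEquiv_under]
    simp only [Window.baseChange, LinearEquiv.trans_apply, LinearEquiv.apply_symm_apply]
    rw [key, FilMod.twistEquiv_twist]

end Windows

/-- The ring `R / pR`. -/
abbrev ModP (p : ℕ) (R : Type u) [CommRing R] : Type u := R ⧸ Ideal.span {(p : R)}

theorem modP_eq_zero (p : ℕ) (R : Type u) [CommRing R] : (p : ModP p R) = 0 := by
  rw [← map_natCast (Ideal.Quotient.mk (Ideal.span {(p : R)}))]
  exact Ideal.Quotient.eq_zero_iff_mem.mpr (Ideal.mem_span_singleton_self _)

/-! ### The Witt frame -/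

section Witt

open WittVector

variable {p : ℕ} [hp : Fact p.Prime] {R : Type u} [CommRing R]

theorem exists_iterate_verschiebung {m : ℕ} {X : WittVector p R} (h : ∀ i < m, X.coeff i = 0) :
    ∃ Y : WittVector p R, verschiebung^[m] Y = X ∧ Y.coeff 0 = X.coeff m := by
  refine ⟨X.shift m, (eq_iterate_verschiebung h).symm, by simp [shift_coeff]⟩

theorem iterate_verschiebung_nsmul (m k : ℕ) (Y : WittVector p R) :
    k • verschiebung^[m] Y = verschiebung^[m] (k • Y) := by
  induction m generalizing Y with
  | zero => rfl
  | succ m ih => rw [Function.iterate_succ_apply, Function.iterate_succ_apply, ih, map_nsmul]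

theorem nsmul_coeff_zero (k : ℕ) (Y : WittVector p R) : (k • Y).coeff 0 = k • Y.coeff 0 :=
  map_nsmul (constantCoeff (p := p) (R := R)) k Y

/-- Multiplication by `p ^ a = 0` raises the order of vanishing of a Witt vector. -/
theorem coeff_pow_nsmul {a : ℕ} (ha : (p : R) ^ a = 0) {m : ℕ} {X : WittVector p R}
    (h : ∀ i < m, X.coeff i = 0) : ∀ i < m + 1, (p ^ a • X).coeff i = 0 := by
  obtain ⟨Y, rfl, -⟩ := exists_iterate_verschiebung h
  intro i hi
  rw [iterate_verschiebung_nsmul]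
  rcases Nat.lt_succ_iff_lt_or_eq.mp hi with hi | rfl
  · exact iterate_verschiebung_coeff_eq_zero _ hi
  · have h := iterate_verschiebung_coeff (p ^ a • Y) i 0
    rw [zero_add] at h
    rw [h, nsmul_coeff_zero, nsmul_eq_mul, Nat.cast_pow, ha, zero_mul]

theorem truncated_isNilpotent_p (hR : IsNilpotent (p : R)) (m : ℕ) :
    IsNilpotent (p : TruncatedWittVector p m R) := by
  obtain ⟨a, ha⟩ := hR
  have key : ∀ m : ℕ, ∀ i < m, ((p ^ a) ^ m • (1 : WittVector p R)).coeff i = 0 := by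
    intro m
    induction m with
    | zero => simp
    | succ m ih => rw [pow_succ', mul_smul]; exact coeff_pow_nsmul ha ih
  refine ⟨a * m, ?_⟩
  have h := (mem_ker_truncate (p := p) (R := R) m _).mpr (key m)
  rw [RingHom.mem_ker, map_nsmul, map_one, nsmul_one] at h
  rw [pow_mul]
  exact_mod_cast h

/-- A truncated Witt vector with vanishing zeroth component is nilpotent when `p` is. -/
theorem isNilpotent_truncate (hR : IsNilpotent (p : R)) (m : ℕ) {X : WittVector p R}
    (h : X.coeff 0 = 0) : IsNilpotent (WittVector.truncate m X) := by
  obtain ⟨Y, rfl, -⟩ := exists_iterate_verschiebung (m := 1) (X := X) (by simpa using h)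
  obtain ⟨N, hN⟩ := truncated_isNilpotent_p hR m
  have key : ∀ k : ℕ, (verschiebung Y) ^ (k + 1) = (p : WittVector p R) ^ k *
      verschiebung (Y ^ (k + 1)) := by
    intro k
    induction k with
    | zero => simp
    | succ k ih =>
      rw [pow_succ, ih, mul_assoc, ← verschiebung_mul_frobenius, frobenius_verschiebung, ← mul_assoc,
        ← pow_succ, mul_comm _ (p : WittVector p R), ← nsmul_eq_mul, map_nsmul, nsmul_eq_mul,
        ← mul_assoc, ← pow_succ]
  refine ⟨N + 1, ?_⟩
  rw [← map_pow, Function.iterate_one, key, map_mul, map_pow, map_natCast, hN, zero_mul]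

theorem isUnit_one_add (hR : IsNilpotent (p : R)) {X : WittVector p R} (h : X.coeff 0 = 0) :
    IsUnit (1 + X) := by
  have hu : ∀ m, ∃ z, WittVector.truncate m (1 + X) * z = 1 := fun m => by
    rw [map_add, map_one]
    exact (isNilpotent_truncate hR m h).isUnit_one_add.exists_right_inv
  choose z hz using hu
  have hc : ∀ (k m : ℕ) (hk : k ≤ m), TruncatedWittVector.truncate hk (z m) = z k := by
    intro k m hk
    have h1 : WittVector.truncate k (1 + X) * TruncatedWittVector.truncate hk (z m) = 1 := by
      rw [← TruncatedWittVector.truncate_wittVector_truncate hk, ← map_mul, hz, map_one]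
    calc _ = (WittVector.truncate k (1 + X) * z k) * TruncatedWittVector.truncate hk (z m) := by
          rw [hz, one_mul]
      _ = (WittVector.truncate k (1 + X) * TruncatedWittVector.truncate hk (z m)) * z k := by ring
      _ = z k := by rw [h1, one_mul]
  let Z : WittVector p R := WittVector.mk' fun k => (z (k + 1)).coeff (Fin.last k)
  have hZ : ∀ m, WittVector.truncate m Z = z m := by
    intro m
    ext i
    have e := hc (i + 1) m i.2
    rw [WittVector.coeff_truncate]
    change (z (i + 1)).coeff (Fin.last i) = _
    rw [← e, TruncatedWittVector.coeff_truncate]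
    rfl
  refine IsUnit.of_mul_eq_one Z ?_
  ext i
  have := congrArg (TruncatedWittVector.coeff (Fin.last i)) (hz (i + 1))
  rw [← hZ, ← map_mul, ← map_one (WittVector.truncate (p := p) (R := R) (i + 1)),
    WittVector.coeff_truncate, WittVector.coeff_truncate] at this
  exact this

theorem shift_add {X Y : WittVector p R} (hX : X.coeff 0 = 0) (hY : Y.coeff 0 = 0) :
    (X + Y).shift 1 = X.shift 1 + Y.shift 1 := by
  obtain ⟨X, rfl, -⟩ := exists_iterate_verschiebung (m := 1) (X := X) (by simpa using hX)
  obtain ⟨Y, rfl, -⟩ := exists_iterate_verschiebung (m := 1) (X := Y) (by simpa using hY)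
  have h : ∀ Z : WittVector p R, (verschiebung Z).shift 1 = Z := fun Z => by
    ext i; rw [shift_coeff, add_comm, verschiebung_coeff_succ]
  simp only [Function.iterate_one]
  rw [← map_add, h, h, h]

theorem shift_mul (X : WittVector p R) {Y : WittVector p R} (hY : Y.coeff 0 = 0) :
    (X * Y).shift 1 = frobenius X * Y.shift 1 := by
  obtain ⟨Y, rfl, -⟩ := exists_iterate_verschiebung (m := 1) (X := Y) (by simpa using hY)
  have h : ∀ Z : WittVector p R, (verschiebung Z).shift 1 = Z := fun Z => by
    ext i; rw [shift_coeff, add_comm, verschiebung_coeff_succ]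
  simp only [Function.iterate_one]
  rw [mul_comm X, ← verschiebung_mul_frobenius, h, h, mul_comm]

theorem p_mul_shift {Y : WittVector p R} (hY : Y.coeff 0 = 0) :
    (p : WittVector p R) * Y.shift 1 = frobenius Y := by
  obtain ⟨Y, rfl, -⟩ := exists_iterate_verschiebung (m := 1) (X := Y) (by simpa using hY)
  have h : ∀ Z : WittVector p R, (verschiebung Z).shift 1 = Z := fun Z => by
    ext i; rw [shift_coeff, add_comm, verschiebung_coeff_succ]
  simp only [Function.iterate_one]
  rw [h, frobenius_verschiebung, mul_comm]

variable (p R)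

/-- The Witt frame `(W(R), I_R, W(R), F, F^div)` of a ring `R` in which `p` is nilpotent. Here `I_R`
is the kernel of `W(R) → R`, and `F^div` is the inverse of the Verschiebung, which shifts the
components, `(0, x₁, x₂, …) ↦ (x₁, x₂, …)`. -/
abbrev wittFrame (hR : IsNilpotent (p : R)) : Frame.{u} p where
  A := WittVector p R
  I := RingHom.ker (constantCoeff (p := p) (R := R))
  S := WittVector p R
  incl := Submodule.subtype _
  incl_mem_jacobson x := by
    rw [Ideal.mem_jacobson_bot]
    intro y
    rw [add_comm]
    refine isUnit_one_add hR ?_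
    have hx : x.1.coeff 0 = 0 := x.2
    change (x.1 * y).coeff 0 = 0
    rw [mul_coeff_zero, hx, zero_mul]
  proj := RingHom.id _
  proj_surjective := Function.surjective_id
  sigma := WittVector.frobenius
  sigmaDiv :=
    { toFun := fun x => x.1.shift 1
      map_add' := fun x y => shift_add x.2 y.2
      map_smul' := fun w x => shift_mul w x.2 }
  p_mul_sigmaDiv x := p_mul_shift x.2

theorem verschiebung_sigmaDiv (hR : IsNilpotent (p : R)) (x : (wittFrame p R hR).I) :
    verschiebung ((wittFrame p R hR).sigmaDiv x) = (wittFrame p R hR).incl x := by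
  change verschiebung (x.1.shift 1) = x.1
  obtain ⟨Y, hY, -⟩ := exists_iterate_verschiebung (m := 1) (X := x.1)
    (by intro i hi; obtain rfl : i = 0 := by omega
        exact x.2)
  rw [← hY]
  ext i
  cases i with
  | zero => simp
  | succ i => simp [shift_coeff, add_comm]

/-! ### The truncated Witt frames -/

section Truncated

variable (n : ℕ)

/-- `x = (0, …, 0, r)` with `p r = 0`. -/
def IsLastTorsion (x : TruncatedWittVector p (n + 1) R) : Prop :=
  (∀ i : Fin n, x.coeff i.castSucc = 0) ∧ (p : R) * x.coeff (Fin.last n) = 0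

variable {p R n} in
theorem isLastTorsion_iff {x : TruncatedWittVector p (n + 1) R} : IsLastTorsion p R n x ↔
    ∃ Y : WittVector p R, WittVector.truncate (n + 1) (verschiebung^[n] Y) = x ∧
      (p : R) * Y.coeff 0 = 0 := by
  constructor
  · rintro ⟨h1, h2⟩
    obtain ⟨X, rfl⟩ := WittVector.truncate_surjective p (n + 1) R x
    obtain ⟨Y, rfl, hY⟩ := exists_iterate_verschiebung (m := n) (X := X) (fun i hi => by
      have h := h1 ⟨i, hi⟩
      rwa [WittVector.coeff_truncate] at h)
    refine ⟨Y, rfl, ?_⟩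
    rw [hY]
    rwa [WittVector.coeff_truncate] at h2
  · rintro ⟨Y, rfl, hY⟩
    refine ⟨fun i => ?_, ?_⟩
    · rw [WittVector.coeff_truncate]
      exact iterate_verschiebung_coeff_eq_zero _ i.2
    · have h := iterate_verschiebung_coeff Y n 0
      rw [zero_add] at h
      rw [WittVector.coeff_truncate, Fin.val_last, h, hY]

/-- The ideal `(0, …, 0, R[p])` of `W_{n + 1}(R)`. -/
def lastTorsion : Ideal (TruncatedWittVector p (n + 1) R) where
  carrier := {x | IsLastTorsion p R n x}
  zero_mem' := by simp [IsLastTorsion]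
  add_mem' := by
    intro x y hx hy
    obtain ⟨X, rfl, hX⟩ := isLastTorsion_iff.mp hx
    obtain ⟨Y, rfl, hY⟩ := isLastTorsion_iff.mp hy
    refine isLastTorsion_iff.mpr ⟨X + Y, ?_, ?_⟩
    · rw [iterate_map_add, map_add]
    · rw [add_coeff_zero, mul_add, hX, hY, add_zero]
  smul_mem' := by
    intro x y hy
    obtain ⟨X, rfl⟩ := WittVector.truncate_surjective p (n + 1) R x
    obtain ⟨Y, rfl, hY⟩ := isLastTorsion_iff.mp hy
    refine isLastTorsion_iff.mpr ⟨Y * frobenius^[n] X, ?_, ?_⟩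
    · rw [← iterate_verschiebung_mul_left, map_mul, smul_eq_mul, mul_comm]
    · rw [mul_coeff_zero, ← mul_assoc, hY, zero_mul]

/-- The ring `𝒲_n(R) = W_{n + 1}(R) / (0, …, 0, R[p])`. -/
abbrev CalW : Type u := TruncatedWittVector p (n + 1) R ⧸ lastTorsion p R n

/-- The augmentation ideal `I_{n + 1, R}`, the kernel of `W_{n + 1}(R) → W_1(R) = R`. -/
def truncIdeal : Ideal (TruncatedWittVector p (n + 1) R) :=
  RingHom.ker (TruncatedWittVector.truncate (p := p) (R := R) (Nat.succ_le_succ (Nat.zero_le n)))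

variable {p R n} in
theorem mem_truncIdeal_iff {X : WittVector p R} :
    WittVector.truncate (n + 1) X ∈ truncIdeal p R n ↔ X.coeff 0 = 0 := by
  rw [truncIdeal, RingHom.mem_ker, TruncatedWittVector.truncate_wittVector_truncate,
    ← RingHom.mem_ker, mem_ker_truncate]
  simp

/-- The `W_{n + 1}(R)`-module structure of `I_{n + 1, R}` factors through `𝒲_n(R)`. -/
theorem truncIdeal_isTorsionBySet :
    Module.IsTorsionBySet (TruncatedWittVector p (n + 1) R) (truncIdeal p R n)
      (lastTorsion p R n : Set (TruncatedWittVector p (n + 1) R)) := by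
  rintro ⟨y, hy⟩ ⟨x, hx⟩
  ext1
  change x * y = 0
  obtain ⟨X, rfl, hX⟩ := isLastTorsion_iff.mp hx
  obtain ⟨Y, rfl⟩ := WittVector.truncate_surjective p (n + 1) R y
  have hY0 := mem_truncIdeal_iff.mp hy
  obtain ⟨Z, rfl, -⟩ := exists_iterate_verschiebung (m := 1) (X := Y) (by simpa using hY0)
  rw [← map_mul, ← RingHom.mem_ker, mem_ker_truncate, iterate_verschiebung_mul_left]
  intro i hi
  rcases Nat.lt_succ_iff_lt_or_eq.mp hi with hi | rfl
  · exact iterate_verschiebung_coeff_eq_zero _ hi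
  · have h := iterate_verschiebung_coeff (X * frobenius^[i] (verschiebung^[1] Z)) i 0
    rw [zero_add] at h
    rw [h]
    cases i with
    | zero => simp [mul_coeff_zero]
    | succ i =>
      rw [Function.iterate_succ_apply, Function.iterate_one, frobenius_verschiebung, mul_comm Z,
        ← nsmul_eq_mul, iterate_map_nsmul, mul_coeff_zero, nsmul_coeff_zero, nsmul_eq_mul,
        ← mul_assoc, mul_comm (X.coeff 0), hX, zero_mul]

instance : Module (CalW p R n) (truncIdeal p R n) :=
  (truncIdeal_isTorsionBySet p R n).module

/-- The inclusion `I_{n + 1, R} → W_{n + 1}(R)`, followed by the projection to `𝒲_n(R)`. -/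
def truncIncl : truncIdeal p R n →ₗ[CalW p R n] CalW p R n where
  toFun x := Ideal.Quotient.mk _ x.1
  map_add' x y := rfl
  map_smul' w x := by
    obtain ⟨w, rfl⟩ := Ideal.Quotient.mk_surjective w
    rfl

theorem truncate_frobenius_eq_zero {X : WittVector p R} (h : WittVector.truncate (n + 1) X = 0) :
    WittVector.truncate n (WittVector.frobenius X) = 0 := by
  rw [← RingHom.mem_ker, mem_ker_truncate] at h
  obtain ⟨Y, rfl, -⟩ := exists_iterate_verschiebung h
  rw [Function.iterate_succ_apply', frobenius_verschiebung, map_mul]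
  have : WittVector.truncate n (verschiebung^[n] Y) = 0 := by
    rw [← RingHom.mem_ker, mem_ker_truncate]
    exact fun i hi => iterate_verschiebung_coeff_eq_zero _ hi
  rw [this, zero_mul]

/-- The Frobenius `W_{n + 1}(R) → W_n(R)`. -/
def truncFrobeniusAux : TruncatedWittVector p (n + 1) R →+* TruncatedWittVector p n R :=
  RingHom.liftOfRightInverse (WittVector.truncate (n + 1)) TruncatedWittVector.out
    TruncatedWittVector.truncateFun_out
    ⟨(WittVector.truncate n).comp WittVector.frobenius,
      fun _ h => truncate_frobenius_eq_zero p R n h⟩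

theorem truncFrobeniusAux_truncate (X : WittVector p R) :
    truncFrobeniusAux p R n (WittVector.truncate (n + 1) X) =
      WittVector.truncate n (WittVector.frobenius X) :=
  RingHom.liftOfRightInverse_comp_apply _ _ _ _ _

theorem truncFrobeniusAux_eq_zero {x : TruncatedWittVector p (n + 1) R}
    (hx : x ∈ lastTorsion p R n) : truncFrobeniusAux p R n x = 0 := by
  obtain ⟨X, rfl, hX⟩ := isLastTorsion_iff.mp hx
  rw [truncFrobeniusAux_truncate, ← RingHom.mem_ker, mem_ker_truncate]
  intro i hi
  obtain ⟨k, rfl⟩ : ∃ k, n = k + 1 := ⟨n - 1, by omega⟩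
  rw [Function.iterate_succ_apply', frobenius_verschiebung, mul_comm, ← nsmul_eq_mul,
    iterate_verschiebung_nsmul]
  rcases Nat.lt_succ_iff_lt_or_eq.mp hi with hi | rfl
  · exact iterate_verschiebung_coeff_eq_zero _ hi
  · have h := iterate_verschiebung_coeff (p • X) i 0
    rw [zero_add] at h
    rw [h, nsmul_coeff_zero, nsmul_eq_mul, hX]

/-- The Frobenius `F : 𝒲_n(R) → W_n(R)`. -/
def truncFrobenius : CalW p R n →+* TruncatedWittVector p n R :=
  Ideal.Quotient.lift _ (truncFrobeniusAux p R n) fun _ h => truncFrobeniusAux_eq_zero p R n h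

/-- The projection `𝒲_n(R) → W_n(R)`. -/
def truncProj : CalW p R n →+* TruncatedWittVector p n R :=
  Ideal.Quotient.lift _ (TruncatedWittVector.truncate (Nat.le_succ n)) fun x hx => by
    ext i
    rw [TruncatedWittVector.coeff_truncate, TruncatedWittVector.coeff_zero]
    exact hx.1 i

/-- The map `W_{n + 1}(R) → W_n(R)`, `(x₀, x₁, …, x_n) ↦ (x₁, …, x_n)`. -/
def truncShift (x : TruncatedWittVector p (n + 1) R) : TruncatedWittVector p n R :=
  TruncatedWittVector.mk p fun i => x.coeff i.succ

theorem truncShift_truncate (X : WittVector p R) :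
    truncShift p R n (WittVector.truncate (n + 1) X) = WittVector.truncate n (X.shift 1) := by
  ext i
  rw [truncShift, TruncatedWittVector.coeff_mk, WittVector.coeff_truncate,
    WittVector.coeff_truncate, shift_coeff, Fin.val_succ, add_comm]

/-- The divided Frobenius `F^div : I_{n + 1, R} → W_n(R)`, that is the inverse of the Verschiebung,
`(0, x₁, …, x_n) ↦ (x₁, …, x_n)`. -/
def truncSigmaDiv : truncIdeal p R n →ₛₗ[truncFrobenius p R n] TruncatedWittVector p n R where
  toFun x := truncShift p R n x.1
  map_add' := by
    rintro ⟨x, hx⟩ ⟨y, hy⟩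
    obtain ⟨X, rfl⟩ := WittVector.truncate_surjective p (n + 1) R x
    obtain ⟨Y, rfl⟩ := WittVector.truncate_surjective p (n + 1) R y
    rw [mem_truncIdeal_iff] at hx hy
    change truncShift p R n (WittVector.truncate (n + 1) X + WittVector.truncate (n + 1) Y) = _
    rw [← map_add, truncShift_truncate, shift_add hx hy, map_add, truncShift_truncate,
      truncShift_truncate]
  map_smul' := by
    rintro w ⟨x, hx⟩
    obtain ⟨w, rfl⟩ := Ideal.Quotient.mk_surjective w
    obtain ⟨W, rfl⟩ := WittVector.truncate_surjective p (n + 1) R w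
    obtain ⟨X, rfl⟩ := WittVector.truncate_surjective p (n + 1) R x
    rw [mem_truncIdeal_iff] at hx
    change truncShift p R n (WittVector.truncate (n + 1) W * WittVector.truncate (n + 1) X) =
      truncFrobeniusAux p R n (WittVector.truncate (n + 1) W) * _
    rw [← map_mul, truncShift_truncate, shift_mul W hx, map_mul, truncShift_truncate,
      truncFrobeniusAux_truncate]

/-- The `n`-truncated Witt frame `(𝒲_n(R), I_{n + 1, R}, W_n(R), F, F^div)`. -/
abbrev truncWittFrame (hR : IsNilpotent (p : R)) : Frame.{u} p where
  A := CalW p R n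
  I := truncIdeal p R n
  S := TruncatedWittVector p n R
  incl := truncIncl p R n
  incl_mem_jacobson := by
    rintro ⟨x, hx⟩
    obtain ⟨X, rfl⟩ := WittVector.truncate_surjective p (n + 1) R x
    rw [mem_truncIdeal_iff] at hx
    have h := ((isNilpotent_truncate hR (n + 1) hx).map (Ideal.Quotient.mk (lastTorsion p R n)))
    rw [Ideal.mem_jacobson_bot]
    intro y
    rw [add_comm _ (1 : CalW p R n)]
    exact ((Commute.all _ y).isNilpotent_mul_right h).isUnit_one_add
  proj := truncProj p R n
  proj_surjective :=
    Ideal.Quotient.lift_surjective_of_surjective _ _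
      (TruncatedWittVector.truncate_surjective (Nat.le_succ n))
  sigma := truncFrobenius p R n
  sigmaDiv := truncSigmaDiv p R n
  p_mul_sigmaDiv := by
    rintro ⟨x, hx⟩
    obtain ⟨X, rfl⟩ := WittVector.truncate_surjective p (n + 1) R x
    rw [mem_truncIdeal_iff] at hx
    change (p : TruncatedWittVector p n R) * truncShift p R n (WittVector.truncate (n + 1) X) =
      truncFrobeniusAux p R n (WittVector.truncate (n + 1) X)
    rw [truncShift_truncate, truncFrobeniusAux_truncate, ← p_mul_shift hx, map_mul, map_natCast]

/-- The truncation homomorphism from the Witt frame to the `n`-truncated Witt frame. -/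
def truncHom (hR : IsNilpotent (p : R)) :
    FrameHom (wittFrame p R hR) (truncWittFrame p R n hR) where
  onA := (Ideal.Quotient.mk (lastTorsion p R n)).comp (WittVector.truncate (n + 1))
  onS := WittVector.truncate n
  onI :=
    { toFun := fun x => (⟨WittVector.truncate (n + 1) x.1, mem_truncIdeal_iff.mpr x.2⟩ :
        truncIdeal p R n)
      map_add' := fun x y => Subtype.ext (map_add (WittVector.truncate (n + 1)) x.1 y.1)
      map_smul' := fun w x => Subtype.ext (map_mul (WittVector.truncate (n + 1)) w x.1) }
  incl_comm _ := rfl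
  proj_comm := TruncatedWittVector.truncate_comp_wittVector_truncate (Nat.le_succ n)
  sigma_comm := RingHom.ext fun X => truncFrobeniusAux_truncate p R n X
  sigmaDiv_comm x := truncShift_truncate p R n x.1

end Truncated

/-! ### Displays and truncated displays -/

/-- Displays over a ring `R` in which `p` is nilpotent. -/
abbrev Display (hR : IsNilpotent (p : R)) : Type (u + 1) := Window (wittFrame p R hR)

/-- `n`-truncated displays over a ring `R` in which `p` is nilpotent. -/
abbrev TruncDisplay (n : ℕ) (hR : IsNilpotent (p : R)) : Type (u + 1) :=
  Window (truncWittFrame p R n hR)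

variable {p R} {hR : IsNilpotent (p : R)}

/-- The truncation `P[n]` of a display. -/
abbrev Display.trunc (P : Display p R hR) (n : ℕ) : TruncDisplay p R n hR :=
  Window.baseChange (truncHom p R n hR) P

/-- The truncation `f[n] : P[n] → Q[n]` of a morphism of displays. -/
abbrev Display.truncMor {P Q : Display p R hR} (f : Window.Hom P Q) (n : ℕ) :
    Window.Hom (Display.trunc P n) (Display.trunc Q n) :=
  Window.Hom.baseChange (truncHom p R n hR) f

/-! ### Nilpotence -/

/-- The Frobenius `x ↦ x ^ p` of a ring (possibly zero) in which `p = 0`. -/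
def frob (p : ℕ) [hp : Fact p.Prime] (k : Type u) [CommRing k] (hk : (p : k) = 0) : k →+* k where
  toFun x := x ^ p
  map_one' := one_pow p
  map_mul' x y := mul_pow x y p
  map_zero' := zero_pow hp.out.ne_zero
  map_add' x y := by
    obtain ⟨r, hr⟩ := exists_add_pow_prime_eq hp.out x y
    rw [hr, hk]
    ring

/-- For a ring endomorphism `φ` of `k` and a linear map `z : N → N^φ`, the composition
`z^{(φ^(m - 1))} ∘ ⋯ ∘ z^{(φ)} ∘ z : N → N^{(φ^m)}`, where `N^{(φ^m)}` is the base change of `N`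
along the `m`-th iterate of `φ`. -/
def iterTwist {k : Type u} [CommRing k] (φ : k →+* k) {N : Type u} [AddCommGroup N] [Module k N]
    (z : N →ₗ[k] BC φ N) : (m : ℕ) → N →ₗ[k] BC (φ ^ m) N
  | 0 => BC.of (RingHom.id k)
  | m + 1 => (BC.compEquiv φ (φ ^ m) (φ ^ (m + 1)) (pow_succ φ m).symm N).toLinearMap ∘ₗ
      BC.map (φ ^ m) z ∘ₗ iterTwist φ z m

variable (p R) in
/-- The projection `W(R) → R → R / pR`. -/
def residue : WittVector p R →+* ModP p R :=
  (Ideal.Quotient.mk (Ideal.span {(p : R)})).comp constantCoeff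

variable (p R) in
theorem residue_frobenius :
    (residue p R).comp WittVector.frobenius =
      (frob p (ModP p R) (modP_eq_zero p R)).comp (residue p R) := by
  ext X
  have h0 : (WittVector.frobenius X).coeff 0 = X.coeff 0 ^ p + p * X.coeff 1 := by
    have h := ghostComponent_frobenius 0 X
    simpa [ghostComponent_apply, wittPolynomial_zero, wittPolynomial_one, add_comm] using h
  change Ideal.Quotient.mk _ ((WittVector.frobenius X).coeff 0) =
    (Ideal.Quotient.mk (Ideal.span {(p : R)}) (X.coeff 0)) ^ p
  rw [h0, map_add, map_mul, map_natCast, modP_eq_zero, zero_mul, add_zero, map_pow]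

/-- `P` is nilpotent of nilpotence order less or equal than `e`: for `N = (R / pR) ⊗_{W(R)} L` and
the reduction `z : N → N^{(p)}` of the component `L → L^F` of `Ψ⁻¹`, the `e`-fold composition
`z^{(p^(e - 1))} ∘ ⋯ ∘ z : N → N^{(p^e)}` vanishes. -/
def Display.IsNilpotentOfOrderLE (P : Display p R hR) (e : ℕ) : Prop :=
  iterTwist (frob p (ModP p R) (modP_eq_zero p R))
    (Window.zBar P (residue p R) (residue p R) rfl _ (residue_frobenius p R)) e = 0

end Witt

end Displays

end

noncomputable section

namespace Displays

open WittVector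

/-! ### Filtrations of the ring of Witt vectors -/

section WittScalars

variable {p : ℕ} [hp : Fact p.Prime] {R : Type u} [CommRing R] {R₁ : Type u} [CommRing R₁]

/-! In coordinates a morphism of displays becomes a solution of a semilinear system over `W(R)`. Let
`M` be the matrix of `Ψ'` and `N` that of `Ψ⁻¹`, and let `U` be the matrix of the morphism, whose
upper right block is `V(B)`. Compatibility with `Ψ` says that `U = M · tw(U, B) · N`, where `tw`
applies `F` to the other blocks, replaces the upper right one by `B` and puts a factor `p` on the
lower left one. Expanded, this is `U = L₁ F(U) + L₂ B`, `V(B) = L₃ F(U) + L₄ B`, where `L₄` is the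
operator `B ↦ M₁₁ B N₂₂`. The block `N₂₂` represents `L → L^F`, so nilpotence of the source forces
the entries of `L₄ F(L₄) ⋯ F^{k-1}(L₄)`, for `k = e + 1`, to have zeroth component in `pR`.

If `f[n] = p g_n`, lift `g_n` to a homomorphism of pairs, not necessarily compatible with `Ψ`. Its
coordinates `(X, Y)` solve the system modulo `V^n`, and the solution `(U, B)` given by `f` is
congruent to `p(X, Y)` modulo `V^n`. By `exists_divided_solution`, for large `n` there is an exact
solution `(U', B')` with `(U, B) = p(U', B')`, and it comes from a morphism (`exists_hom_of_isSol`).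
The other implication is base change.

The division is an induction on the exponent of `p`. When `p = 0` in `R`, the differences `U - pX`
and `B - pY` are deep in the `V`-adic filtration. Unrolling the equation for `V(B)` `k` times
expresses `B - pY` as a multiple of `p` plus `F(L₄ ⋯ F^{k-1}(L₄))` applied to a vector; the product
has the form `V(Z)`, and `F V = p` (`exists_divided_vector`). As `p` may be a zero divisor, the
quotient is shown separately to satisfy the divided equation.

For the step, let `𝔞 = p^{a+1} R` with `p^{a+2} = 0`, so that `𝔞² = 0` and `p𝔞 = 0`. On `W(𝔞)` both
`F` and `p` vanish, and so does every Witt vector with zeroth component in `pR`. A quotient over `R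
/ 𝔞` is lifted and corrected by elements of `W(𝔞)` to a solution (`exists_sol_of_small_defect`); `p`
times it differs from `(U, B)` by a small solution in `W(𝔞)`, which is zero
(`IsSol.eq_zero_of_small`). -/

variable (p R) in
/-- The ideal `V^n W(R)` of Witt vectors whose first `n` components vanish. -/
def wittFil (n : ℕ) : Ideal (WittVector p R) := RingHom.ker (WittVector.truncate n)

theorem mem_wittFil {n : ℕ} {x : WittVector p R} : x ∈ wittFil p R n ↔ ∀ i < n, x.coeff i = 0 :=
  mem_ker_truncate _ _

theorem wittFil_anti {m n : ℕ} (h : m ≤ n) : wittFil p R n ≤ wittFil p R m :=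
  fun _ hx => mem_wittFil.mpr fun i hi => mem_wittFil.mp hx i (hi.trans_le h)

theorem coeff_iterate_verschiebung_add (x : WittVector p R) (k i : ℕ) :
    (verschiebung^[k] x).coeff (k + i) = x.coeff i := by
  rw [add_comm]; exact iterate_verschiebung_coeff x k i

theorem exists_iterate_verschiebung_of_mem {k m : ℕ} {x : WittVector p R}
    (hx : x ∈ wittFil p R (k + m)) : ∃ y ∈ wittFil p R m, verschiebung^[k] y = x := by
  rw [mem_wittFil] at hx
  obtain ⟨y, rfl, -⟩ := exists_iterate_verschiebung (m := k) fun i hi => hx i (by omega)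
  refine ⟨y, mem_wittFil.mpr fun i hi => ?_, rfl⟩
  rw [← coeff_iterate_verschiebung_add y k i]
  exact hx _ (by omega)

/-- Since `F V = p`, and over a general `R` multiplication by `p` need not deepen the `V`-adic
level, one level is lost. Every estimate of a defect has to pay for it. -/
theorem frobenius_mem_wittFil {n : ℕ} {x : WittVector p R} (hx : x ∈ wittFil p R (n + 1)) :
    frobenius x ∈ wittFil p R n :=
  truncate_frobenius_eq_zero p R n hx

theorem verschiebung_mem_wittFil {n : ℕ} {x : WittVector p R} (hx : x ∈ wittFil p R n) :
    verschiebung x ∈ wittFil p R n := by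
  rw [mem_wittFil] at hx ⊢
  rintro (_ | i) hi
  · exact verschiebung_coeff_zero x
  · rw [verschiebung_coeff_succ]; exact hx i (by omega)

theorem verschiebung_frobenius_of_eq_zero (h : (p : R) = 0) (x : WittVector p R) :
    verschiebung (frobenius x) = p * x := by
  rcases subsingleton_or_nontrivial R with hR | hR
  -- The zero ring is set apart because `CharP R p` fails there.
  · ext i; exact Subsingleton.elim _ _
  · have : CharP R p := (CharP.charP_iff_prime_eq_zero hp.out).mpr h
    rw [verschiebung_frobenius, mul_comm]

theorem map_wittFrobenius (q : R →+* R₁) (x : WittVector p R) :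
    WittVector.map q (frobenius x) = frobenius (WittVector.map q x) :=
  (frobenius_isPoly p).map q x

theorem iterate_verschiebung_map (q : R →+* R₁) (k : ℕ) (x : WittVector p R) :
    WittVector.map q (verschiebung^[k] x) = verschiebung^[k] (WittVector.map q x) := by
  induction k generalizing x with
  | zero => rfl
  | succ k ih =>
    rw [Function.iterate_succ_apply, Function.iterate_succ_apply, ih, map_verschiebung]

/-- The `n`-th component of `F(x)` is `x_n ^ p + p · aux_n(x)`. Evaluating at `0` over `ℤ`, where
`p` can be cancelled, shows that `aux_n` has no constant term, so it maps tuples in an ideal into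
that ideal. -/
theorem constantCoeff_frobeniusPolyAux (n : ℕ) :
    MvPolynomial.aeval (fun _ => (0 : ℤ)) (frobeniusPolyAux p n) = 0 := by
  have h := coeff_frobenius (p := p) (0 : WittVector p ℤ) n
  rw [map_zero, frobeniusPoly] at h
  simp only [map_add, map_pow, map_mul, MvPolynomial.aeval_X, MvPolynomial.aeval_C] at h
  have h0 : (0 : WittVector p ℤ).coeff = fun _ => 0 := funext fun i => WittVector.zero_coeff p ℤ i
  rw [h0] at h
  simp only [zero_pow hp.out.ne_zero, zero_add] at h
  rcases mul_eq_zero.mp h.symm with h | h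
  · exact absurd (by simpa using h) hp.out.ne_zero
  · exact h

/-- The Frobenius vanishes on `W(𝔞)` when `𝔞² = 0` and `p𝔞 = 0`. -/
theorem frobenius_eq_zero_of_map_eq_zero (q : R →+* R₁)
    (hq2 : ∀ x y, q x = 0 → q y = 0 → x * y = 0) (hqp : ∀ x, q x = 0 → (p : R) * x = 0)
    {x : WittVector p R} (hx : WittVector.map q x = 0) :
    frobenius x = 0 := by
  have hc : ∀ i, q (x.coeff i) = 0 := fun i => by
    rw [← WittVector.map_coeff, hx, WittVector.zero_coeff]
  ext n
  rw [coeff_frobenius, frobeniusPoly]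
  simp only [map_add, map_pow, map_mul, MvPolynomial.aeval_X, MvPolynomial.aeval_C]
  -- With `𝔞 = ker q`: the power contains a product of two elements of `𝔞`, and the auxiliary
  -- polynomial takes a value in `𝔞`, which `p` kills.
  have h1 : x.coeff n ^ p = 0 := by
    rw [← pow_sub_mul_pow _ hp.out.two_le, pow_two, hq2 _ _ (hc n) (hc n), mul_zero]
  have h2 : q (MvPolynomial.aeval x.coeff (frobeniusPolyAux p n)) = 0 := by
    rw [MvPolynomial.aeval_def, MvPolynomial.hom_eval₂]
    have : (fun i => q (x.coeff i)) = fun _ => (Int.castRingHom R₁) 0 := by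
      funext i; rw [hc, map_zero]
    rw [this]
    have h := congrArg (Int.castRingHom R₁) (constantCoeff_frobeniusPolyAux (p := p) n)
    rw [MvPolynomial.aeval_def, MvPolynomial.hom_eval₂, map_zero] at h
    rw [map_zero, Subsingleton.elim (q.comp (algebraMap ℤ R))]
    exact h
  rw [h1, zero_add, WittVector.zero_coeff]
  have := hqp _ h2
  simpa using this

/-- Write `p = F V`: the Verschiebung preserves `W(𝔞)`, and `F` vanishes there. -/
theorem natCast_mul_eq_zero_of_map_eq_zero (q : R →+* R₁)
    (hq2 : ∀ x y, q x = 0 → q y = 0 → x * y = 0) (hqp : ∀ x, q x = 0 → (p : R) * x = 0)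
    {x : WittVector p R} (hx : WittVector.map q x = 0) :
    (p : WittVector p R) * x = 0 := by
  rw [mul_comm, ← frobenius_verschiebung]
  refine frobenius_eq_zero_of_map_eq_zero q hq2 hqp ?_
  rw [map_verschiebung, hx, map_zero]

/-- A Witt vector with zeroth component `p s` is `p [s] + V z`. On `W(𝔞)` the first summand acts as
zero because `p` does, the second because `V z · x = V(z · F x)`. In this way nilpotence modulo `p`
is usable over rings in which `p ≠ 0`. -/
theorem mul_eq_zero_of_map_eq_zero (q : R →+* R₁)
    (hq2 : ∀ x y, q x = 0 → q y = 0 → x * y = 0) (hqp : ∀ x, q x = 0 → (p : R) * x = 0)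
    {x w : WittVector p R} {s : R} (hw : w.coeff 0 = p * s)
    (hx : WittVector.map q x = 0) : w * x = 0 := by
  have h0 : (w - (p : WittVector p R) * teichmuller p s).coeff 0 = 0 := by
    change constantCoeff (w - (p : WittVector p R) * teichmuller p s) = 0
    rw [map_sub, map_mul, map_natCast]
    change w.coeff 0 - (p : R) * (teichmuller p s).coeff 0 = 0
    rw [hw, teichmuller_coeff_zero, sub_self]
  obtain ⟨z, hz, -⟩ := exists_iterate_verschiebung (m := 1) (X := w - (p : WittVector p R) * teichmuller p s)
    (by simpa using h0)
  have : w = (p : WittVector p R) * teichmuller p s + verschiebung z := by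
    rw [← Function.iterate_one (verschiebung : WittVector p R → WittVector p R), hz]; ring
  rw [this, add_mul, ← verschiebung_mul_frobenius,
    frobenius_eq_zero_of_map_eq_zero q hq2 hqp hx, mul_zero, map_zero, add_zero, mul_right_comm,
    natCast_mul_eq_zero_of_map_eq_zero q hq2 hqp hx, zero_mul]

/-- A Witt vector over a quotient lifts, with the first `m` components prescribed. -/
theorem exists_lift_of_truncate_eq (q : R →+* R₁) (hq : Function.Surjective q) (m : ℕ) (x : WittVector p R)
    (y : WittVector p R₁) (h : WittVector.map q x - y ∈ wittFil p R₁ m) :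
    ∃ z : WittVector p R, WittVector.map q z = y ∧ z - x ∈ wittFil p R m := by
  have h' : ∀ i < m, q (x.coeff i) = y.coeff i := by
    intro i hi
    have h1 : WittVector.truncate m (WittVector.map q x) = WittVector.truncate m y := by
      rw [← sub_eq_zero, ← map_sub]; exact h
    have := congrArg (TruncatedWittVector.coeff ⟨i, hi⟩) h1
    rwa [coeff_truncate, coeff_truncate, map_coeff] at this
  choose l hl using hq
  -- Truncations agree exactly when components do, so the first `m` components are copied and the
  -- others are lifted freely.
  let z : WittVector p R := WittVector.mk' fun i => if i < m then x.coeff i else l (y.coeff i)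
  have hz : ∀ i, z.coeff i = if i < m then x.coeff i else l (y.coeff i) := fun i => rfl
  refine ⟨z, ?_, ?_⟩
  · ext i
    rw [map_coeff, hz]
    split_ifs with hi
    · exact h' i hi
    · exact hl _
  · rw [wittFil, RingHom.mem_ker, map_sub, sub_eq_zero]
    ext i
    rw [coeff_truncate, coeff_truncate, hz, if_pos i.2]

end WittScalars

end Displays

end

noncomputable section

namespace Displays

open WittVector Matrix

/-! ### Vectors of Witt vectors -/

section Vectors

variable {p : ℕ} [hp : Fact p.Prime] {R : Type u} [CommRing R] {R₁ : Type u} [CommRing R₁]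
variable {r s t : Type*}

/-- The entrywise Verschiebung. -/
def vecV : (s → WittVector p R) →+ (s → WittVector p R) :=
  (verschiebung : WittVector p R →+ WittVector p R).compLeft s

/-- The entrywise Frobenius. -/
def vecF : (s → WittVector p R) →+ (s → WittVector p R) :=
  (frobenius : WittVector p R →+* WittVector p R).toAddMonoidHom.compLeft s

/-- The entrywise map `W(R) → W(R₁)`. -/
def vecMap (q : R →+* R₁) : (s → WittVector p R) →+ (s → WittVector p R₁) :=
  (WittVector.map q).toAddMonoidHom.compLeft s

/-- The vectors with entries in an ideal. -/
def vecIn {A : Type*} [CommRing A] (I : Ideal A) (s : Type*) : Submodule A (s → A) :=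
  Submodule.pi Set.univ fun _ => I

@[simp] theorem vecV_apply (x : s → WittVector p R) (i : s) : vecV x i = verschiebung (x i) := rfl

@[simp] theorem vecF_apply (x : s → WittVector p R) (i : s) : vecF x i = frobenius (x i) := rfl

@[simp] theorem vecMap_apply (q : R →+* R₁) (x : s → WittVector p R) (i : s) :
    vecMap q x i = WittVector.map q (x i) := rfl

theorem mem_vecIn {A : Type*} [CommRing A] {I : Ideal A} {x : s → A} :
    x ∈ vecIn I s ↔ ∀ i, x i ∈ I := by
  simp [vecIn, Submodule.mem_pi]

theorem mulVec_mem_vecIn [Fintype s] {A : Type*} [CommRing A] {I : Ideal A} (M : Matrix r s A) {x : s → A}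
    (hx : x ∈ vecIn I s) : M *ᵥ x ∈ vecIn I r :=
  mem_vecIn.mpr fun _ => Ideal.sum_mem _ fun j _ => I.mul_mem_left _ (mem_vecIn.mp hx j)

theorem vecIn_mono {A : Type*} [CommRing A] {I J : Ideal A} (h : I ≤ J) : vecIn I s ≤ vecIn J s :=
  fun _ hx => mem_vecIn.mpr fun i => h (mem_vecIn.mp hx i)

theorem vecV_injective : Function.Injective (vecV : (s → WittVector p R) → _) :=
  fun _ _ h => funext fun i => verschiebung_injective p R (congrFun h i)

theorem vecV_mem {n : ℕ} {x : s → WittVector p R} (hx : x ∈ vecIn (wittFil p R n) s) :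
    vecV x ∈ vecIn (wittFil p R n) s :=
  mem_vecIn.mpr fun i => verschiebung_mem_wittFil (mem_vecIn.mp hx i)

theorem vecF_mem {n : ℕ} {x : s → WittVector p R} (hx : x ∈ vecIn (wittFil p R (n + 1)) s) :
    vecF x ∈ vecIn (wittFil p R n) s :=
  mem_vecIn.mpr fun i => frobenius_mem_wittFil (mem_vecIn.mp hx i)

theorem vecMap_mem (q : R →+* R₁) {n : ℕ} {x : s → WittVector p R}
    (hx : x ∈ vecIn (wittFil p R n) s) : vecMap q x ∈ vecIn (wittFil p R₁ n) s := by
  refine mem_vecIn.mpr fun i => mem_wittFil.mpr fun j hj => ?_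
  rw [vecMap_apply, map_coeff, mem_wittFil.mp (mem_vecIn.mp hx i) j hj, map_zero]

theorem iterate_vecV_apply (k : ℕ) (x : s → WittVector p R) (i : s) :
    vecV^[k] x i = verschiebung^[k] (x i) := by
  induction k generalizing x with
  | zero => rfl
  | succ k ih => rw [Function.iterate_succ_apply, Function.iterate_succ_apply, ih, vecV_apply]

theorem iterate_vecV_injective (k : ℕ) :
    Function.Injective (vecV^[k] : (s → WittVector p R) → _) := vecV_injective.iterate k

theorem exists_iterate_vecV {k m : ℕ} {x : s → WittVector p R}
    (hx : x ∈ vecIn (wittFil p R (k + m)) s) :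
    ∃ y ∈ vecIn (wittFil p R m) s, vecV^[k] y = x := by
  choose y hy hyx using fun i => exists_iterate_verschiebung_of_mem (mem_vecIn.mp hx i)
  exact ⟨y, mem_vecIn.mpr hy, funext fun i => by rw [iterate_vecV_apply, hyx]⟩

theorem vecMap_iterate_vecV (q : R →+* R₁) (k : ℕ) (x : s → WittVector p R) :
    vecMap q (vecV^[k] x) = vecV^[k] (vecMap q x) := by
  funext i
  rw [vecMap_apply, iterate_vecV_apply, iterate_vecV_apply, iterate_verschiebung_map, vecMap_apply]

theorem vecMap_vecV (q : R →+* R₁) (x : s → WittVector p R) :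
    vecMap q (vecV x) = vecV (vecMap q x) := vecMap_iterate_vecV q 1 x

theorem vecMap_vecF (q : R →+* R₁) (x : s → WittVector p R) :
    vecMap q (vecF x) = vecF (vecMap q x) :=
  funext fun _ => map_wittFrobenius _ _

theorem vecF_vecV (x : s → WittVector p R) : vecF (vecV x) = p • x :=
  funext fun i => by
    rw [vecF_apply, vecV_apply, frobenius_verschiebung, Pi.smul_apply, nsmul_eq_mul, mul_comm]

theorem vecV_vecF (h : (p : R) = 0) (x : s → WittVector p R) : vecV (vecF x) = p • x :=
  funext fun i => by
    rw [vecV_apply, vecF_apply, verschiebung_frobenius_of_eq_zero h, Pi.smul_apply, nsmul_eq_mul]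

theorem vecF_eq_zero_of_vecMap (q : R →+* R₁)
    (hq2 : ∀ x y, q x = 0 → q y = 0 → x * y = 0)
    (hqp : ∀ x, q x = 0 → (p : R) * x = 0) {x : r → WittVector p R} (hx : vecMap q x = 0) :
    vecF x = 0 :=
  funext fun i => frobenius_eq_zero_of_map_eq_zero q hq2 hqp (congrFun hx i)

theorem nsmul_eq_zero_of_vecMap (q : R →+* R₁)
    (hq2 : ∀ x y, q x = 0 → q y = 0 → x * y = 0)
    (hqp : ∀ x, q x = 0 → (p : R) * x = 0) {x : r → WittVector p R} (hx : vecMap q x = 0) :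
    p • x = 0 :=
  funext fun i => by
    rw [Pi.smul_apply, nsmul_eq_mul,
      natCast_mul_eq_zero_of_map_eq_zero q hq2 hqp (congrFun hx i), Pi.zero_apply]

theorem vecMap_eq_zero_of_iterate (q : R →+* R₁) {k : ℕ} {y : s → WittVector p R}
    (hy : vecMap q (vecV^[k] y) = 0) : vecMap q y = 0 := by
  rw [vecMap_iterate_vecV] at hy
  apply iterate_vecV_injective (p := p) (R := R₁) k
  rw [hy, iterate_map_zero]

theorem exists_vec_lift (q : R →+* R₁) (hq : Function.Surjective q) (m : ℕ) (x : s → WittVector p R)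
    (y : s → WittVector p R₁) (h : y - vecMap q x ∈ vecIn (wittFil p R₁ m) s) :
    ∃ z : s → WittVector p R, vecMap q z = y ∧ z - x ∈ vecIn (wittFil p R m) s := by
  choose z hz hzx using fun i => exists_lift_of_truncate_eq q hq m (x i) (y i) (by
    rw [← neg_sub, neg_mem_iff]; exact mem_vecIn.mp h i)
  exact ⟨z, funext hz, mem_vecIn.mpr hzx⟩

/-- The `k`-fold Frobenius twist of a matrix. -/
def frobTwist (k : ℕ) (M : Matrix r s (WittVector p R)) : Matrix r s (WittVector p R) :=
  M.map (frobenius^[k])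

theorem frobTwist_zero (M : Matrix r s (WittVector p R)) : frobTwist 0 M = M := by
  ext; rfl

theorem frobTwist_succ' (k : ℕ) (M : Matrix r s (WittVector p R)) :
    frobTwist (k + 1) M = (frobTwist k M).map frobenius := by
  ext i j : 1
  simp only [frobTwist, map_apply, Function.iterate_succ_apply']

variable [Fintype s]

theorem vecMap_mulVec (q : R →+* R₁) (M : Matrix r s (WittVector p R)) (x : s → WittVector p R) :
    vecMap q (M *ᵥ x) = M.map (WittVector.map q) *ᵥ vecMap q x :=
  funext fun i => RingHom.map_mulVec (WittVector.map q) M x i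

/-- The projection formula `V(F(a) x) = a V(x)`, which moves coefficients across `V`. -/
theorem vecV_map_mulVec (M : Matrix r s (WittVector p R)) (x : s → WittVector p R) :
    vecV (M.map frobenius *ᵥ x) = M *ᵥ vecV x := by
  funext i
  simp only [vecV_apply, mulVec, dotProduct, map_sum, map_apply]
  refine Finset.sum_congr rfl fun j _ => ?_
  rw [mul_comm, verschiebung_mul_frobenius, mul_comm]

theorem vecV_mulVec_vecF (M : Matrix r s (WittVector p R)) (x : s → WittVector p R) :
    vecV (M *ᵥ vecF x) = M.map verschiebung *ᵥ x := by
  funext i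
  simp only [vecV_apply, mulVec, dotProduct, map_sum, map_apply]
  refine Finset.sum_congr rfl fun j _ => ?_
  rw [vecF_apply, verschiebung_mul_frobenius]

theorem mulVec_eq_zero_of_vecMap (q : R →+* R₁)
    (hq2 : ∀ x y, q x = 0 → q y = 0 → x * y = 0)
    (hqp : ∀ x, q x = 0 → (p : R) * x = 0) {M : Matrix s s (WittVector p R)}
    (hM : ∀ i j, ∃ t, (M i j).coeff 0 = p * t) {x : s → WittVector p R} (hx : vecMap q x = 0) :
    M *ᵥ x = 0 :=
  funext fun i => Finset.sum_eq_zero fun j _ => by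
    obtain ⟨t, ht⟩ := hM i j
    exact mul_eq_zero_of_map_eq_zero q hq2 hqp ht (congrFun hx j)

theorem iterate_vecV_frobTwist (k : ℕ) (M : Matrix r s (WittVector p R))
    (x : s → WittVector p R) : vecV^[k] (frobTwist k M *ᵥ x) = M *ᵥ vecV^[k] x := by
  induction k generalizing x with
  | zero => rw [frobTwist_zero]; rfl
  | succ k ih =>
    rw [Function.iterate_succ_apply, Function.iterate_succ_apply, frobTwist_succ',
      vecV_map_mulVec, ih]

theorem map_verschiebung_mul (M : Matrix r s (WittVector p R)) (N : Matrix s t (WittVector p R)) :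
    (M.map frobenius * N).map verschiebung = M * N.map verschiebung := by
  ext i j : 1
  simp only [map_apply, mul_apply, map_sum]
  refine Finset.sum_congr rfl fun l _ => ?_
  rw [mul_comm, verschiebung_mul_frobenius, mul_comm]

theorem map_verschiebung_mul' (M : Matrix r s (WittVector p R)) (N : Matrix s t (WittVector p R)) :
    (M * N.map frobenius).map verschiebung = M.map verschiebung * N := by
  ext i j : 1
  simp only [map_apply, mul_apply, map_sum]
  exact Finset.sum_congr rfl fun l _ => verschiebung_mul_frobenius _ _

/-- Pulling `V^k` out turns the coefficient `L` into `F^k(L)`; then `V^k` is cancelled by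
injectivity. -/
theorem vecV_eq_of_iterate (L : Matrix s s (WittVector p R)) (k : ℕ) {β K : s → WittVector p R}
    (h : vecV (vecV^[k] β) = L *ᵥ vecV^[k] β + p • vecV^[k] K) :
    vecV β = frobTwist k L *ᵥ β + p • K := by
  apply iterate_vecV_injective (p := p) (R := R) k
  rw [← Function.iterate_succ_apply, Function.iterate_succ_apply', h, iterate_map_add,
    iterate_vecV_frobTwist, iterate_map_nsmul]

variable [DecidableEq s]

/-- The product `L F(L) ⋯ F^{k - 1}(L)`. -/
def frobProd (L : Matrix s s (WittVector p R)) : ℕ → Matrix s s (WittVector p R)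
  | 0 => 1
  | k + 1 => L * (frobProd L k).map frobenius

/-- The definition splits off the first factor. Splitting off the last one matches the recursion `V
β = F^k(L) β + p K`. -/
theorem frobProd_succ' (L : Matrix s s (WittVector p R)) (k : ℕ) :
    frobProd L (k + 1) = frobProd L k * frobTwist k L := by
  induction k with
  | zero => simp [frobProd, frobTwist_zero]
  | succ k ih =>
    rw [frobProd, ih, Matrix.map_mul, ← mul_assoc, frobTwist_succ', ← frobProd, ← ih]

theorem frobProd_map (q : R →+* R₁) (L : Matrix s s (WittVector p R)) (k : ℕ) :
    frobProd (L.map (WittVector.map q)) k = (frobProd L k).map (WittVector.map q) := by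
  induction k with
  | zero => simp [frobProd]
  | succ k ih =>
    rw [frobProd, frobProd, Matrix.map_mul, ih]
    congr 1
    ext i j : 1
    simp only [map_apply, map_wittFrobenius]

/-- The approximate solution `∑_{j < k} F(L) ⋯ F^j(L) V^{k - 1 - j} E` of `V b - L b = V^k E`. -/
def frobSum (L : Matrix s s (WittVector p R)) :
    ℕ → (s → WittVector p R) → (s → WittVector p R)
  | 0, _ => 0
  | k + 1, E => frobSum L k (vecV E) + (frobProd L k).map frobenius *ᵥ E

/-- The sum telescopes: by the projection formula `V` sends the summand with index `j > 0` to `L`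
times the preceding one. What survives is `V^k E` from the first summand and `L F(L) ⋯ F^{k-1}(L) E`
from the last. -/
theorem vecV_frobSum (L : Matrix s s (WittVector p R)) (k : ℕ) (E : s → WittVector p R) :
    vecV (frobSum L k E) = L *ᵥ frobSum L k E + (vecV^[k] E - frobProd L k *ᵥ E) := by
  induction k generalizing E with
  | zero => simp [frobSum, frobProd]
  | succ k ih =>
    rw [frobSum, map_add, ih, vecV_map_mulVec, mulVec_add, Function.iterate_succ_apply, frobProd,
      ← mulVec_mulVec]
    abel

theorem frobSum_mem_fil (L : Matrix s s (WittVector p R)) (k : ℕ) {m : ℕ}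
    {E : s → WittVector p R} (hE : E ∈ vecIn (wittFil p R m) s) :
    frobSum L k E ∈ vecIn (wittFil p R m) s := by
  induction k generalizing E with
  | zero => exact Submodule.zero_mem _
  | succ k ih => exact Submodule.add_mem _ (ih (vecV_mem hE)) (mulVec_mem_vecIn _ hE)

theorem vecMap_frobSum_eq_zero (q : R →+* R₁) (L : Matrix s s (WittVector p R)) (k : ℕ)
    {E : s → WittVector p R} (hE : vecMap q E = 0) : vecMap q (frobSum L k E) = 0 := by
  induction k generalizing E with
  | zero => exact map_zero _
  | succ k ih =>
    rw [frobSum, map_add, ih (by rw [vecMap_vecV, hE, map_zero]), vecMap_mulVec, hE, mulVec_zero,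
      add_zero]

theorem frobSum_zero (L : Matrix s s (WittVector p R)) (k : ℕ) : frobSum L k 0 = 0 := by
  induction k with
  | zero => rfl
  | succ k ih => rw [frobSum, map_zero, ih, mulVec_zero, add_zero]

/-- The equation `V β = F^k(L) β + p K` is substituted into `V^k β` from the inside, each time with
the appropriate twist of `L`. Every substitution yields one term of `frobSum` and one factor of the
product. If the product is `V(Z)`, the right side is `p Z β`. -/
theorem iterate_vecV_sub_frobSum (L : Matrix s s (WittVector p R)) (k : ℕ)
    {β K : s → WittVector p R}
    (h : vecV (vecV^[k] β) = L *ᵥ vecV^[k] β + p • vecV^[k] K) :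
    vecV^[k] β - p • frobSum L k K = (frobProd L k).map frobenius *ᵥ β := by
  induction k generalizing β K with
  | zero => simp [frobSum, frobProd]
  | succ k ih =>
    have h1 := vecV_eq_of_iterate L (k + 1) h
    rw [Function.iterate_succ_apply, Function.iterate_succ_apply] at h
    have h2 := ih h
    rw [frobSum, Function.iterate_succ_apply, smul_add, ← sub_sub, h2, ← mulVec_smul, ← mulVec_sub,
      h1, add_sub_cancel_right, frobProd_succ', Matrix.map_mul, ← mulVec_mulVec, frobTwist_succ']

end Vectors

/-! ### Semilinear systems over the ring of Witt vectors

Morphisms of displays are the solutions `(U, B)` of a system of equations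
`U = L₁ F(U) + L₂ B`, `V(B) = L₃ F(U) + L₄ B`. -/

/-- The coefficients of a system `U = L₁ F(U) + L₂ B`, `V(B) = L₃ F(U) + L₄ B`. -/
structure WittSystem (p : ℕ) [Fact p.Prime] (R : Type u) [CommRing R] (r s : Type*) where
  L₁ : Matrix r r (WittVector p R)
  L₂ : Matrix r s (WittVector p R)
  L₃ : Matrix s r (WittVector p R)
  L₄ : Matrix s s (WittVector p R)

namespace WittSystem

variable {p : ℕ} [hp : Fact p.Prime] {R : Type u} [CommRing R] {R₁ : Type u} [CommRing R₁]
variable {r s : Type*}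

/-- The base change of a system along a ring homomorphism. -/
def map (Λ : WittSystem p R r s) (q : R →+* R₁) : WittSystem p R₁ r s where
  L₁ := Λ.L₁.map (WittVector.map q)
  L₂ := Λ.L₂.map (WittVector.map q)
  L₃ := Λ.L₃.map (WittVector.map q)
  L₄ := Λ.L₄.map (WittVector.map q)

variable [Fintype r] [Fintype s] (Λ : WittSystem p R r s)

/-- The error `U - L₁ F(U) - L₂ B` in the first equation. -/
def defect₁ (U : r → WittVector p R) (B : s → WittVector p R) : r → WittVector p R :=
  U - Λ.L₁ *ᵥ vecF U - Λ.L₂ *ᵥ B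

/-- The error `V(B) - L₃ F(U) - L₄ B` in the second equation. -/
def defect₂ (U : r → WittVector p R) (B : s → WittVector p R) : s → WittVector p R :=
  vecV B - Λ.L₃ *ᵥ vecF U - Λ.L₄ *ᵥ B

/-- `(U, B)` solves the system. -/
def IsSol (U : r → WittVector p R) (B : s → WittVector p R) : Prop :=
  Λ.defect₁ U B = 0 ∧ Λ.defect₂ U B = 0

theorem defect₁_sub (U U' : r → WittVector p R) (B B' : s → WittVector p R) :
    Λ.defect₁ (U - U') (B - B') = Λ.defect₁ U B - Λ.defect₁ U' B' := by
  simp only [defect₁, map_sub, mulVec_sub]; abel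

theorem defect₂_sub (U U' : r → WittVector p R) (B B' : s → WittVector p R) :
    Λ.defect₂ (U - U') (B - B') = Λ.defect₂ U B - Λ.defect₂ U' B' := by
  simp only [defect₂, map_sub, mulVec_sub]; abel

theorem defect₁_nsmul (n : ℕ) (U : r → WittVector p R) (B : s → WittVector p R) :
    Λ.defect₁ (n • U) (n • B) = n • Λ.defect₁ U B := by
  simp only [defect₁, map_nsmul, mulVec_smul, smul_sub]

theorem defect₂_nsmul (n : ℕ) (U : r → WittVector p R) (B : s → WittVector p R) :
    Λ.defect₂ (n • U) (n • B) = n • Λ.defect₂ U B := by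
  simp only [defect₂, map_nsmul, mulVec_smul, smul_sub]

theorem defect₁_map (q : R →+* R₁) (U : r → WittVector p R) (B : s → WittVector p R) :
    (Λ.map q).defect₁ (vecMap q U) (vecMap q B) = vecMap q (Λ.defect₁ U B) := by
  simp only [defect₁, map_sub, vecMap_mulVec, vecMap_vecF, map]

theorem defect₂_map (q : R →+* R₁) (U : r → WittVector p R) (B : s → WittVector p R) :
    (Λ.map q).defect₂ (vecMap q U) (vecMap q B) = vecMap q (Λ.defect₂ U B) := by
  simp only [defect₂, map_sub, vecMap_mulVec, vecMap_vecF, vecMap_vecV, map]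

/-- The unknown `U` must lie one level deeper than `B` because it enters through its Frobenius. -/
theorem defect₁_mem {n : ℕ} {U : r → WittVector p R} {B : s → WittVector p R}
    (hU : U ∈ vecIn (wittFil p R (n + 1)) r) (hB : B ∈ vecIn (wittFil p R n) s) :
    Λ.defect₁ U B ∈ vecIn (wittFil p R n) r :=
  Submodule.sub_mem _ (Submodule.sub_mem _ (vecIn_mono (wittFil_anti n.le_succ) hU)
    (mulVec_mem_vecIn _ (vecF_mem hU))) (mulVec_mem_vecIn _ hB)

theorem defect₂_mem {n : ℕ} {U : r → WittVector p R} {B : s → WittVector p R}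
    (hU : U ∈ vecIn (wittFil p R (n + 1)) r) (hB : B ∈ vecIn (wittFil p R n) s) :
    Λ.defect₂ U B ∈ vecIn (wittFil p R n) s :=
  Submodule.sub_mem _ (Submodule.sub_mem _ (vecV_mem hB)
    (mulVec_mem_vecIn _ (vecF_mem hU))) (mulVec_mem_vecIn _ hB)

variable {Λ}

theorem IsSol.sub_nsmul {U U' : r → WittVector p R} {B B' : s → WittVector p R}
    (h : Λ.IsSol U B) (h' : Λ.IsSol U' B') (n : ℕ) : Λ.IsSol (U - n • U') (B - n • B') := by
  constructor
  · rw [defect₁_sub, defect₁_nsmul, h.1, h'.1, smul_zero, sub_zero]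
  · rw [defect₂_sub, defect₂_nsmul, h.2, h'.2, smul_zero, sub_zero]

theorem IsSol.map {U : r → WittVector p R} {B : s → WittVector p R}
    (h : Λ.IsSol U B) (q : R →+* R₁) : (Λ.map q).IsSol (vecMap q U) (vecMap q B) := by
  constructor
  · rw [defect₁_map, h.1, map_zero]
  · rw [defect₂_map, h.2, map_zero]

variable [DecidableEq s]

/-- The linear part of the division problem in characteristic `p`. -/
theorem exists_divided_vector (hR : (p : R) = 0) (L : Matrix s s (WittVector p R)) (k m : ℕ)
    (hL : ∀ i j, (frobProd L k i j).coeff 0 = 0) {b K : s → WittVector p R}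
    (hb : b ∈ vecIn (wittFil p R (k + (1 + m))) s) (hK : K ∈ vecIn (wittFil p R (k + m)) s)
    (h : vecV b = L *ᵥ b + p • K) :
    ∃ b' ∈ vecIn (wittFil p R m) s, b = p • b' ∧ vecV b' = L *ᵥ b' + K := by
  obtain ⟨K, hKm, rfl⟩ := exists_iterate_vecV hK
  obtain ⟨β, hβ, rfl⟩ := exists_iterate_vecV hb
  obtain ⟨β₁, hβ₁, hβ₁β⟩ := exists_iterate_vecV hβ
  change vecV β₁ = β at hβ₁β
  -- Nilpotence enters here: Witt vectors with zeroth component `0` are in the image of `V`.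
  have hZ : ∃ Z : Matrix s s (WittVector p R), Z.map verschiebung = frobProd L k := by
    have := fun i j => exists_iterate_verschiebung (m := 1) (X := frobProd L k i j)
      (by simpa using hL i j)
    choose Z hZ _ using this
    exact ⟨Matrix.of Z, by ext i j : 1; exact hZ i j⟩
  obtain ⟨Z, hZ⟩ := hZ
  have h1 := vecV_eq_of_iterate L k h
  have h2 : β - vecF K = frobTwist (k + 1) L *ᵥ β₁ := by
    apply vecV_injective (p := p) (R := R)
    rw [map_sub, vecV_vecF hR, h1, add_sub_cancel_right, frobTwist_succ', vecV_map_mulVec, hβ₁β]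
  -- After applying the injective `V`, both sides are the product of `k + 1` factors, with the last
  -- factor split off on the left and the first one on the right; the latter uses `V F = p = F V`.
  have h3 : Z * frobTwist (k + 1) L = L.map frobenius * Z.map frobenius := by
    have hinj : Function.Injective
        (fun M : Matrix s s (WittVector p R) => M.map verschiebung) := fun M N h => by
      ext i j : 1
      exact verschiebung_injective p R (congrFun (congrFun h i) j)
    apply hinj
    change (Z * _).map verschiebung = (_ * Z.map frobenius).map verschiebung
    rw [frobTwist_succ', map_verschiebung_mul', map_verschiebung_mul, hZ, ← frobProd_succ',
      frobProd, ← hZ]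
    congr 1
    ext i j : 1
    simp only [map_apply, frobenius_verschiebung, verschiebung_frobenius_of_eq_zero hR, mul_comm]
  -- The inhomogeneous term is exactly the error that `frobSum` leaves by `vecV_frobSum`, so that
  -- the sum of the two solves the equation.
  have h4 : vecV (Z *ᵥ β) = L *ᵥ (Z *ᵥ β) + frobProd L k *ᵥ K := by
    have e1 : vecV (Z *ᵥ (β - vecF K)) = L *ᵥ (Z *ᵥ β) := by
      rw [h2, mulVec_mulVec, h3, ← mulVec_mulVec, vecV_map_mulVec, vecV_map_mulVec, hβ₁β]
    rw [← e1, ← hZ, ← vecV_mulVec_vecF, ← map_add, mulVec_sub, sub_add_cancel]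
  have h5 : (frobProd L k).map frobenius *ᵥ β = p • (Z *ᵥ β) := by
    rw [← hZ]
    funext i
    simp only [mulVec, dotProduct, map_apply, frobenius_verschiebung, Pi.smul_apply,
      Finset.smul_sum, nsmul_eq_mul]
    exact Finset.sum_congr rfl fun j _ => by ring
  -- The equation for `b'` does not follow from that for `b` by cancelling `p`, which may be a zero
  -- divisor; this is why `h4` was needed.
  refine ⟨frobSum L k K + Z *ᵥ β, Submodule.add_mem _ (frobSum_mem_fil L k hKm)
    (mulVec_mem_vecIn _ (vecIn_mono (wittFil_anti (by omega)) hβ)), ?_, ?_⟩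
  · rw [smul_add, ← h5, ← iterate_vecV_sub_frobSum L k h, add_sub_cancel]
  · rw [map_add, vecV_frobSum, h4, mulVec_add]; abel

/-- The division problem in characteristic `p`. -/
theorem exists_divided_of_eq_zero (hR : (p : R) = 0) (k m n : ℕ) (hn : k + m + 2 ≤ n)
    (hΛ : ∀ i j, (frobProd Λ.L₄ k i j).coeff 0 = 0)
    {U X : r → WittVector p R} {B Y : s → WittVector p R} (hUB : Λ.IsSol U B)
    (h₁ : Λ.defect₁ X Y ∈ vecIn (wittFil p R n) r) (h₂ : Λ.defect₂ X Y ∈ vecIn (wittFil p R n) s)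
    (hU : U - p • X ∈ vecIn (wittFil p R n) r) (hB : B - p • Y ∈ vecIn (wittFil p R n) s) :
    ∃ U' B', Λ.IsSol U' B' ∧ U = p • U' ∧ B = p • B' ∧
      U' - X ∈ vecIn (wittFil p R m) r ∧ B' - Y ∈ vecIn (wittFil p R m) s := by
  obtain ⟨w, hw, hwU⟩ := exists_iterate_vecV (k := 1) (m := k + m)
    (vecIn_mono (wittFil_anti (by omega)) hU)
  change vecV w = U - p • X at hwU
  -- The Frobenius of a vector in the image of `V` is visibly divisible by `p`, so both equations
  -- for the difference can be divided.
  have hFw : vecF (U - p • X) = p • w := by rw [← hwU, vecF_vecV]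
  have d₁ : Λ.defect₁ (U - p • X) (B - p • Y) = - (p • Λ.defect₁ X Y) := by
    rw [defect₁_sub, defect₁_nsmul, hUB.1, zero_sub]
  have d₂ : Λ.defect₂ (U - p • X) (B - p • Y) = - (p • Λ.defect₂ X Y) := by
    rw [defect₂_sub, defect₂_nsmul, hUB.2, zero_sub]
  have hb : vecV (B - p • Y) =
      Λ.L₄ *ᵥ (B - p • Y) + p • (Λ.L₃ *ᵥ w - Λ.defect₂ X Y) := by
    rw [defect₂, hFw, mulVec_smul] at d₂
    rw [smul_sub, sub_eq_add_neg (p • _), ← d₂]; abel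
  obtain ⟨b', hb', hbb', hVb'⟩ := exists_divided_vector hR Λ.L₄ k m hΛ
    (vecIn_mono (wittFil_anti (by omega)) hB)
    (Submodule.sub_mem _ (mulVec_mem_vecIn _ hw) (vecIn_mono (wittFil_anti (by omega)) h₂)) hb
  -- The first equation for `U - pX`, divided by `p` term by term.
  let u' := Λ.L₁ *ᵥ w + Λ.L₂ *ᵥ b' - Λ.defect₁ X Y
  have hu' : U - p • X = p • u' := by
    rw [defect₁, hFw, mulVec_smul] at d₁
    rw [smul_sub, sub_eq_add_neg (p • _), ← d₁, smul_add, ← mulVec_smul Λ.L₂, ← hbb']; abel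
  -- This makes `u'` satisfy the divided equations: `V F(u') = p u' = V w`, and `V` is injective.
  have hFu' : vecF u' = w := by
    apply vecV_injective (p := p) (R := R)
    rw [vecV_vecF hR, ← hu', hwU]
  have hu'm : u' ∈ vecIn (wittFil p R m) r :=
    Submodule.sub_mem _ (Submodule.add_mem _
      (mulVec_mem_vecIn _ (vecIn_mono (wittFil_anti (by omega)) hw)) (mulVec_mem_vecIn _ hb'))
      (vecIn_mono (wittFil_anti (by omega)) h₁)
  have e₁ : Λ.defect₁ (-u') (-b') = Λ.defect₁ X Y := by
    rw [defect₁, map_neg, hFu', mulVec_neg, mulVec_neg]; simp only [u']; abel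
  have e₂ : Λ.defect₂ (-u') (-b') = Λ.defect₂ X Y := by
    rw [defect₂, map_neg, map_neg, hFu', hVb', mulVec_neg, mulVec_neg]; abel
  refine ⟨X - -u', Y - -b', ⟨?_, ?_⟩, ?_, ?_, ?_, ?_⟩
  · rw [defect₁_sub, e₁, sub_self]
  · rw [defect₂_sub, e₂, sub_self]
  · rw [sub_neg_eq_add, smul_add, ← hu', add_sub_cancel]
  · rw [sub_neg_eq_add, smul_add, ← hbb', add_sub_cancel]
  · simpa using hu'm
  · simpa using hb'

/-! ### Uniqueness and correction of solutions over `W(𝔞)`, where `𝔞² = 0` and `p𝔞 = 0` -/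

section SmallKernel

variable (q : R →+* R₁)

/-- A solution with entries in `W(𝔞)` that is small for the `V`-adic topology vanishes. -/
theorem IsSol.eq_zero_of_small (hq2 : ∀ x y, q x = 0 → q y = 0 → x * y = 0)
    (hqp : ∀ x, q x = 0 → (p : R) * x = 0) (k : ℕ)
    (hΛ : ∀ i j, ∃ t, (frobProd Λ.L₄ k i j).coeff 0 = p * t)
    {U : r → WittVector p R} {B : s → WittVector p R} (h : Λ.IsSol U B)
    (hU : vecMap q U = 0) (hB : vecMap q B = 0) (hBk : B ∈ vecIn (wittFil p R k) s) :
    U = 0 ∧ B = 0 := by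
  have hFU := vecF_eq_zero_of_vecMap q hq2 hqp hU
  have h2 := h.2
  rw [defect₂, hFU, mulVec_zero, sub_zero, sub_eq_zero] at h2
  obtain ⟨β, -, rfl⟩ := exists_iterate_vecV (k := k) (m := 0) hBk
  have hβ := vecMap_eq_zero_of_iterate q hB
  -- With `F(U) = 0` only the homogeneous equation `V B = L₄ B` is left, so it is unrolled with `K =
  -- 0`.
  have e := iterate_vecV_sub_frobSum Λ.L₄ k (β := β) (K := 0) (by
    rw [h2, iterate_map_zero, smul_zero, add_zero])
  rw [frobSum_zero, smul_zero, sub_zero] at e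
  -- One more `V` removes the Frobenius from the product and leaves it acting on `V β`, which lies
  -- in `W(𝔞)` and is therefore killed.
  have hB0 : vecV^[k] β = 0 := by
    apply vecV_injective (p := p) (R := R)
    rw [e, vecV_map_mulVec, map_zero]
    exact mulVec_eq_zero_of_vecMap q hq2 hqp hΛ (by rw [vecMap_vecV, hβ, map_zero])
  refine ⟨?_, hB0⟩
  have h1 := h.1
  rwa [defect₁, hFU, mulVec_zero, sub_zero, hB0, mulVec_zero, sub_zero] at h1

/-- Approximate solutions that are solutions modulo `W(𝔞)` can be corrected. -/
theorem exists_sol_of_small_defect (hq2 : ∀ x y, q x = 0 → q y = 0 → x * y = 0)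
    (hqp : ∀ x, q x = 0 → (p : R) * x = 0) (k m : ℕ)
    (hΛ : ∀ i j, ∃ t, (frobProd Λ.L₄ k i j).coeff 0 = p * t)
    {X : r → WittVector p R} {Y : s → WittVector p R}
    (h₁ : Λ.defect₁ X Y ∈ vecIn (wittFil p R m) r)
    (h₂ : Λ.defect₂ X Y ∈ vecIn (wittFil p R (k + m)) s)
    (hq : (Λ.map q).IsSol (vecMap q X) (vecMap q Y)) :
    ∃ u b, Λ.IsSol (X - u) (Y - b) ∧ vecMap q u = 0 ∧ vecMap q b = 0 ∧
      u ∈ vecIn (wittFil p R m) r ∧ b ∈ vecIn (wittFil p R m) s := by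
  obtain ⟨E, hE, hE₂⟩ := exists_iterate_vecV h₂
  have hq₁ : vecMap q (Λ.defect₁ X Y) = 0 := by rw [← defect₁_map, hq.1]
  have hq₂ : vecMap q E = 0 := vecMap_eq_zero_of_iterate (k := k) q (by
    rw [hE₂, ← defect₂_map, hq.2])
  let b := frobSum Λ.L₄ k E
  have hqb : vecMap q b = 0 := vecMap_frobSum_eq_zero q _ k hq₂
  have hb : b ∈ vecIn (wittFil p R m) s := frobSum_mem_fil _ k hE
  have hVb : vecV b = Λ.L₄ *ᵥ b + Λ.defect₂ X Y := by
    rw [vecV_frobSum, mulVec_eq_zero_of_vecMap q hq2 hqp hΛ hq₂, sub_zero, hE₂]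
  -- As `F(u)` will be zero, the first equation simply prescribes `u`.
  let u := Λ.defect₁ X Y + Λ.L₂ *ᵥ b
  have hqu : vecMap q u = 0 := by
    rw [map_add, hq₁, vecMap_mulVec, hqb, mulVec_zero, add_zero]
  have hFu := vecF_eq_zero_of_vecMap q hq2 hqp hqu
  refine ⟨u, b, ⟨?_, ?_⟩, hqu, hqb, Submodule.add_mem _ h₁ (mulVec_mem_vecIn _ hb), hb⟩
  · have : Λ.defect₁ u b = Λ.defect₁ X Y := by
      rw [defect₁, hFu, mulVec_zero, sub_zero, add_sub_cancel_right]
    rw [defect₁_sub, this, sub_self]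
  · have : Λ.defect₂ u b = Λ.defect₂ X Y := by
      rw [defect₂, hFu, mulVec_zero, sub_zero, hVb, add_sub_cancel_left]
    rw [defect₂_sub, this, sub_self]

end SmallKernel

end WittSystem

/-! ### Division by `p`, by induction on the exponent of `p` -/

open WittSystem in
/-- A solution that is divisible by `p` to sufficiently high order, as an approximate solution, is
divisible by `p`. -/
theorem exists_divided_solution (p : ℕ) [Fact p.Prime] (a k m : ℕ) :
    ∃ n : ℕ, 0 < n ∧ ∀ (R : Type u) [CommRing R] (_ : (p : R) ^ (a + 1) = 0) (r s : Type)
      [Fintype r] [Fintype s] [DecidableEq s] (Λ : WittSystem p R r s)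
      (_ : ∀ i j, ∃ t, (frobProd Λ.L₄ k i j).coeff 0 = p * t)
      (U X : r → WittVector p R) (B Y : s → WittVector p R) (_ : Λ.IsSol U B)
      (_ : Λ.defect₁ X Y ∈ vecIn (wittFil p R n) r) (_ : Λ.defect₂ X Y ∈ vecIn (wittFil p R n) s)
      (_ : U - p • X ∈ vecIn (wittFil p R n) r) (_ : B - p • Y ∈ vecIn (wittFil p R n) s),
      ∃ U' B', Λ.IsSol U' B' ∧ U = p • U' ∧ B = p • B' ∧
        U' - X ∈ vecIn (wittFil p R m) r ∧ B' - Y ∈ vecIn (wittFil p R m) s := by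
  -- The closeness of the quotient to `(X, Y)` belongs to the claim, with `m` free, because the step
  -- must lift a quotient over `R / 𝔞` near `(X, Y)`.
  induction a generalizing m with
  | zero =>
    refine ⟨k + m + 2, by omega, ?_⟩
    intro R _ hR r s _ _ _ Λ hΛ U X B Y hUB h₁ h₂ hU hB
    have hR0 : (p : R) = 0 := by simpa using hR
    refine exists_divided_of_eq_zero hR0 k m _ le_rfl (fun i j => ?_) hUB h₁ h₂ hU hB
    obtain ⟨t, ht⟩ := hΛ i j
    rw [ht, hR0, zero_mul]
  | succ a ih =>
    -- One level is lost to the Frobenius in the defects and `k` levels to the correction, which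
    -- leaves `m`.
    obtain ⟨n, -, hn⟩ := ih (k + m + 1)
    -- Large enough both for the induction hypothesis and for the levels `k + m` and `k` used over
    -- `R` itself.
    refine ⟨n + (k + m) + 1, by omega, ?_⟩
    intro R _ hR r s _ _ _ Λ hΛ U X B Y hUB h₁ h₂ hU hB
    let q := Ideal.Quotient.mk (Ideal.span {(p : R) ^ (a + 1)})
    have hq0 : ∀ x, q x = 0 → ∃ y, x = p ^ (a + 1) * y := fun x hx => by
      obtain ⟨y, hy⟩ := Ideal.mem_span_singleton'.mp (Ideal.Quotient.eq_zero_iff_mem.mp hx)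
      exact ⟨y, by rw [← hy, mul_comm]⟩
    have hqp : ∀ x, q x = 0 → (p : R) * x = 0 := fun x hx => by
      obtain ⟨y, rfl⟩ := hq0 x hx
      rw [← mul_assoc, ← pow_succ', hR, zero_mul]
    have hq2 : ∀ x y, q x = 0 → q y = 0 → x * y = 0 := fun x y hx hy => by
      obtain ⟨x, rfl⟩ := hq0 x hx
      rw [mul_assoc, pow_succ, mul_assoc, ← mul_assoc _ x y, mul_comm _ x, mul_assoc x, hqp y hy,
        mul_zero, mul_zero]
    have hqs : Function.Surjective q := Ideal.Quotient.mk_surjective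
    have hfil : ∀ {l : ℕ}, l ≤ n + (k + m) + 1 → ∀ {t : Type} {x : t → WittVector p R},
        x ∈ vecIn (wittFil p R (n + (k + m) + 1)) t → x ∈ vecIn (wittFil p R l) t :=
      fun hl _ _ hx => vecIn_mono (wittFil_anti hl) hx
    have hnn : n ≤ n + (k + m) + 1 := by omega
    obtain ⟨U₁, B₁, hs, hU₁, hB₁, hUX, hBY⟩ := hn (R ⧸ Ideal.span {(p : R) ^ (a + 1)})
      (by
        have : q ((p : R) ^ (a + 1)) = 0 :=
          Ideal.Quotient.eq_zero_iff_mem.mpr (Ideal.mem_span_singleton_self _)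
        simpa using this) r s (Λ.map q)
      (fun i j => by
        obtain ⟨t, ht⟩ := hΛ i j
        refine ⟨q t, ?_⟩
        change (frobProd (Λ.L₄.map (WittVector.map q)) k i j).coeff 0 = _
        rw [frobProd_map, Matrix.map_apply, WittVector.map_coeff, ht, map_mul, map_natCast])
      (vecMap q U) (vecMap q X) (vecMap q B) (vecMap q Y) (hUB.map q)
      (by rw [defect₁_map]; exact vecMap_mem q (hfil hnn h₁))
      (by rw [defect₂_map]; exact vecMap_mem q (hfil hnn h₂))
      (by rw [← map_nsmul, ← map_sub]; exact vecMap_mem q (hfil hnn hU))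
      (by rw [← map_nsmul, ← map_sub]; exact vecMap_mem q (hfil hnn hB))
    obtain ⟨X', hX', hXX'⟩ := exists_vec_lift q hqs _ X U₁ hUX
    obtain ⟨Y', hY', hYY'⟩ := exists_vec_lift q hqs _ Y B₁ hBY
    have hYY : Y' - Y ∈ vecIn (wittFil p R (k + m)) s :=
      vecIn_mono (wittFil_anti (Nat.le_succ _)) hYY'
    have d₁ : Λ.defect₁ X' Y' ∈ vecIn (wittFil p R (k + m)) r := by
      have h := Submodule.add_mem _ (Λ.defect₁_mem hXX' hYY) (hfil (by omega) h₁)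
      rwa [defect₁_sub, sub_add_cancel] at h
    have d₂ : Λ.defect₂ X' Y' ∈ vecIn (wittFil p R (k + m)) s := by
      have h := Submodule.add_mem _ (Λ.defect₂_mem hXX' hYY) (hfil (by omega) h₂)
      rwa [defect₂_sub, sub_add_cancel] at h
    -- The lifts solve the system modulo `W(𝔞)`, and their defects are deep since those of `(X, Y)`
    -- are.
    obtain ⟨u, b, hub, hqu, hqb, hu, hb⟩ := exists_sol_of_small_defect q hq2 hqp k m hΛ
      (vecIn_mono (wittFil_anti (by omega)) d₁) d₂ (by rw [hX', hY']; exact hs)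
    -- Since `p` kills `W(𝔞)`, the correction does not affect the `p`-multiple.
    have hpu : p • (X' - u) = p • X' := by
      rw [smul_sub, nsmul_eq_zero_of_vecMap q hq2 hqp hqu, sub_zero]
    have hpb : p • (Y' - b) = p • Y' := by
      rw [smul_sub, nsmul_eq_zero_of_vecMap q hq2 hqp hqb, sub_zero]
    -- Over `R / 𝔞` the division is already exact, so this difference of solutions lies in `W(𝔞)`;
    -- being small, it vanishes.
    have hz := (hUB.sub_nsmul hub p).eq_zero_of_small q hq2 hqp k hΛ
      (by rw [hpu, map_sub, map_nsmul, hX', hU₁, sub_self])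
      (by rw [hpb, map_sub, map_nsmul, hY', hB₁, sub_self])
      (by
        rw [hpb]
        have h := Submodule.sub_mem _ (hfil (l := k) (by omega) hB)
          (nsmul_mem (vecIn_mono (wittFil_anti (show k ≤ k + m by omega)) hYY) p)
        rwa [smul_sub, sub_sub_sub_cancel_right] at h)
    refine ⟨X' - u, Y' - b, hub, sub_eq_zero.mp hz.1, sub_eq_zero.mp hz.2, ?_, ?_⟩
    · rw [sub_right_comm]
      exact Submodule.sub_mem _ (vecIn_mono (wittFil_anti (by omega)) hXX') hu
    · rw [sub_right_comm]
      exact Submodule.sub_mem _ (vecIn_mono (wittFil_anti (by omega)) hYY') hb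

end Displays

end

noncomputable section

namespace Displays

open Matrix

/-! ### Dual generating systems of projective modules -/

/-- Generators `v_i` of a module with linear forms `c_i` such that `x = ∑ c_i(x) v_i` for all `x`. -/
structure DualGens (A : Type*) [CommRing A] (X : Type*) [AddCommGroup X] [Module A X]
    (ι : Type*) [Fintype ι] where
  vec : ι → X
  coord : ι → X →ₗ[A] A
  sum_coord : ∀ x, ∑ i, coord i x • vec i = x

namespace DualGens

section Basic

variable {A : Type*} [CommRing A] {X Y Z : Type*} [AddCommGroup X] [Module A X]
  [AddCommGroup Y] [Module A Y] [AddCommGroup Z] [Module A Z]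
  {ι κ l : Type*} [Fintype ι] [Fintype κ] [Fintype l]

/-- A splitting of a surjection `Aⁿ → X`. The modules need not be free, so matrices are taken in
redundant systems, where the identity has an idempotent matrix `ε` in place of `1`. -/
theorem exists_of_projective (A X : Type*) [CommRing A] [AddCommGroup X] [Module A X]
    [Module.Finite A X] [Module.Projective A X] :
    ∃ n : ℕ, Nonempty (DualGens A X (Fin n)) := by
  obtain ⟨n, f, g, -, -, hfg⟩ := Module.Finite.exists_comp_eq_id_of_projective A X
  refine ⟨n, ⟨⟨fun i => f (Pi.single i 1), fun i => LinearMap.proj i ∘ₗ g, fun x => ?_⟩⟩⟩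
  have h : f (g x) = x := LinearMap.congr_fun hfg x
  conv_rhs => rw [← h, pi_eq_sum_univ' (g x), map_sum]
  refine Finset.sum_congr rfl fun i _ => ?_
  rw [map_smul]
  congr 2

/-- The generating system of a direct sum. -/
def prod (b : DualGens A X ι) (b' : DualGens A Y κ) : DualGens A (X × Y) (ι ⊕ κ) where
  vec := Sum.elim (fun i => (b.vec i, 0)) fun i => (0, b'.vec i)
  coord := Sum.elim (fun i => b.coord i ∘ₗ LinearMap.fst A X Y)
    fun i => b'.coord i ∘ₗ LinearMap.snd A X Y
  sum_coord x := by
    have h1 := b.sum_coord x.1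
    have h2 := b'.sum_coord x.2
    refine Prod.ext ?_ ?_ <;> simp [Fintype.sum_sum_type, Prod.fst_sum, Prod.snd_sum, h1, h2]

/-- The matrix of a linear map. -/
def mat (b : DualGens A X ι) (b' : DualGens A Y κ) (φ : X →ₗ[A] Y) : Matrix κ ι A :=
  Matrix.of fun i j => b'.coord i (φ (b.vec j))

variable (b : DualGens A X ι) (b' : DualGens A Y κ) (b'' : DualGens A Z l)

theorem mat_apply (φ : X →ₗ[A] Y) (i : κ) (j : ι) :
    b.mat b' φ i j = b'.coord i (φ (b.vec j)) := rfl

theorem apply_vec (φ : X →ₗ[A] Y) (j : ι) : φ (b.vec j) = ∑ i, b.mat b' φ i j • b'.vec i :=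
  (b'.sum_coord _).symm

theorem mat_comp (ψ : Y →ₗ[A] Z) (φ : X →ₗ[A] Y) :
    b.mat b'' (ψ ∘ₗ φ) = b'.mat b'' ψ * b.mat b' φ := by
  ext i j
  rw [mat_apply, LinearMap.comp_apply, b.apply_vec b' φ j, map_sum, map_sum, mul_apply]
  refine Finset.sum_congr rfl fun k _ => ?_
  rw [map_smul, map_smul, smul_eq_mul, mul_comm, mat_apply b' b'']

/-- Coefficients in a redundant system are not unique; multiplication by `ε` normalizes them. -/
theorem mat_eq_of_apply_vec (φ : X →ₗ[A] Y) (K : Matrix κ ι A)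
    (h : ∀ j, φ (b.vec j) = ∑ i, K i j • b'.vec i) :
    b.mat b' φ = b'.mat b' LinearMap.id * K := by
  ext i j
  rw [mat_apply, h, map_sum, mul_apply]
  refine Finset.sum_congr rfl fun k _ => ?_
  rw [map_smul, smul_eq_mul, mul_comm, mat_apply, LinearMap.id_apply]

theorem id_mul_mat (φ : X →ₗ[A] Y) : b'.mat b' LinearMap.id * b.mat b' φ = b.mat b' φ := by
  rw [← mat_comp, LinearMap.id_comp]

theorem mat_mul_id (φ : X →ₗ[A] Y) : b.mat b' φ * b.mat b LinearMap.id = b.mat b' φ := by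
  rw [← mat_comp, LinearMap.comp_id]

theorem mat_injective : Function.Injective (b.mat b') := by
  intro φ ψ h
  ext x
  rw [← b.sum_coord x, map_sum, map_sum]
  refine Finset.sum_congr rfl fun j _ => ?_
  rw [map_smul, map_smul, b.apply_vec b' φ, b.apply_vec b' ψ, h]

theorem mat_nsmul (n : ℕ) (φ : X →ₗ[A] Y) : b.mat b' (n • φ) = n • b.mat b' φ := by
  ext i j
  simp [mat_apply]

/-- The linear map with given matrix. -/
def ofMat (K : Matrix κ ι A) : X →ₗ[A] Y :=
  ∑ j, ∑ i, K i j • (b.coord j).smulRight (b'.vec i)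

/-- Only the matrices with `ε' K ε = K` are matrices of linear maps; for the others `ofMat` realizes
the compression. -/
theorem mat_ofMat (K : Matrix κ ι A) :
    b.mat b' (b.ofMat b' K) = b'.mat b' LinearMap.id * K * b.mat b LinearMap.id := by
  ext i j
  simp only [mat_apply, ofMat, LinearMap.sum_apply, LinearMap.smul_apply,
    LinearMap.smulRight_apply, map_sum, map_smul, mul_apply, LinearMap.id_apply, smul_eq_mul,
    Finset.sum_mul]
  exact Finset.sum_congr rfl fun k _ => Finset.sum_congr rfl fun m _ => by ring

theorem mat_prod_coprod {X' Y' : Type*} [AddCommGroup X'] [Module A X'] [AddCommGroup Y']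
    [Module A Y'] {ι' κ' : Type*} [Fintype ι'] [Fintype κ'] (c : DualGens A X' ι')
    (c' : DualGens A Y' κ') (f : X →ₗ[A] Y) (g : X' →ₗ[A] Y) (h : X →ₗ[A] Y') (k : X' →ₗ[A] Y') :
    (b.prod c).mat (b'.prod c') ((f.coprod g).prod (h.coprod k)) =
      fromBlocks (b.mat b' f) (c.mat b' g) (b.mat c' h) (c.mat c' k) := by
  ext (i | i) (j | j) <;> simp [mat_apply, prod]

theorem mat_prod_id {X' : Type*} [AddCommGroup X'] [Module A X'] {ι' : Type*} [Fintype ι']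
    (c : DualGens A X' ι') : (b.prod c).mat (b.prod c) LinearMap.id =
      fromBlocks (b.mat b LinearMap.id) 0 0 (c.mat c LinearMap.id) := by
  ext (i | i) (j | j) <;> simp [mat_apply, prod]

end Basic

section BaseChange

variable {A B : Type u} [CommRing A] [CommRing B] {X Y : Type u} [AddCommGroup X] [Module A X]
  [AddCommGroup Y] [Module A Y] {ι κ : Type*} [Fintype ι] [Fintype κ] (f : A →+* B)

/-- The base change of a generating system. -/
def bc (b : DualGens A X ι) : DualGens B (BC f X) ι where
  vec i := BC.of f (b.vec i)
  coord i := BC.lift (f := f) (g := RingHom.id B) (h := f)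
    { toFun := fun x => f (b.coord i x)
      map_add' := fun x y => by rw [map_add, map_add]
      map_smul' := fun a x => by rw [map_smul, smul_eq_mul, map_mul, smul_eq_mul] }
  sum_coord x := by
    induction x using BC.induction with
    | zero => simp
    | smul_of s m =>
      conv_rhs => rw [← b.sum_coord m, map_sum, Finset.smul_sum]
      refine Finset.sum_congr rfl fun i _ => ?_
      rw [map_smul, BC.lift_of, map_smulₛₗ, smul_assoc]
      rfl
    | add x y hx hy =>
      conv_rhs => rw [← hx, ← hy]
      simp only [map_add, add_smul, Finset.sum_add_distrib]

variable (b : DualGens A X ι) (b' : DualGens A Y κ)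

theorem bc_vec (i : ι) : (b.bc f).vec i = BC.of f (b.vec i) := rfl

@[simp]
theorem bc_coord_of (i : ι) (x : X) : (b.bc f).coord i (BC.of f x) = f (b.coord i x) :=
  BC.lift_of _ _

theorem mat_bc_map (φ : X →ₗ[A] Y) :
    (b.bc f).mat (b'.bc f) (BC.map f φ) = (b.mat b' φ).map f := by
  ext i j
  rw [mat_apply, bc_vec, BC.map_of, bc_coord_of, map_apply, mat_apply]

theorem mat_bc_id : (b.bc f).mat (b.bc f) LinearMap.id = (b.mat b LinearMap.id).map f := by
  ext i j
  rw [mat_apply, bc_vec, LinearMap.id_apply, bc_coord_of, map_apply, mat_apply, LinearMap.id_apply]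

end BaseChange

/-! ### Coordinates of `I ⊗ X` with values in the module `I` -/

section Tensor

variable {A : Type*} [CommRing A] {I X : Type*} [AddCommGroup I] [Module A I]
  [AddCommGroup X] [Module A X] {ι : Type*} [Fintype ι] (b : DualGens A X ι)

/-- The coordinates of an element of `I ⊗ X`. -/
def tcoord (i : ι) : I ⊗[A] X →ₗ[A] I :=
  (TensorProduct.rid A I).toLinearMap ∘ₗ LinearMap.lTensor I (b.coord i)

@[simp]
theorem tcoord_tmul (i : ι) (y : I) (x : X) : b.tcoord i (y ⊗ₜ[A] x) = b.coord i x • y := by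
  simp [tcoord]

theorem sum_tcoord (x : I ⊗[A] X) : ∑ i, b.tcoord i x ⊗ₜ[A] b.vec i = x := by
  induction x using TensorProduct.induction_on with
  | zero => simp
  | tmul y x =>
    conv_rhs => rw [← b.sum_coord x, TensorProduct.tmul_sum]
    refine Finset.sum_congr rfl fun i _ => ?_
    rw [tcoord_tmul, TensorProduct.smul_tmul]
  | add x y hx hy =>
    conv_rhs => rw [← hx, ← hy]
    simp only [map_add, TensorProduct.add_tmul, Finset.sum_add_distrib]

variable {Y : Type*} [AddCommGroup Y] [Module A Y] {κ : Type*} [Fintype κ] (c : DualGens A Y κ)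

/-- The matrix, with entries in `I`, of a linear map `Y → I ⊗ X`. -/
def tmat (φ : Y →ₗ[A] I ⊗[A] X) : Matrix ι κ I :=
  Matrix.of fun i j => b.tcoord i (φ (c.vec j))

theorem tmat_apply (φ : Y →ₗ[A] I ⊗[A] X) (i : ι) (j : κ) :
    b.tmat c φ i j = b.tcoord i (φ (c.vec j)) := rfl

theorem tmat_injective : Function.Injective (b.tmat c (I := I)) := by
  intro φ ψ h
  ext x
  rw [← c.sum_coord x, map_sum, map_sum]
  refine Finset.sum_congr rfl fun j _ => ?_
  rw [map_smul, map_smul, ← b.sum_tcoord (φ (c.vec j)), ← b.sum_tcoord (ψ (c.vec j))]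
  congr 1
  refine Finset.sum_congr rfl fun i _ => ?_
  rw [← tmat_apply, ← tmat_apply, h]

/-- The linear map `Y → I ⊗ X` with given matrix. -/
def ofTmat (K : Matrix ι κ I) : Y →ₗ[A] I ⊗[A] X :=
  ∑ j, (c.coord j).smulRight (∑ i, K i j ⊗ₜ[A] b.vec i)

/-- The analogue of `mat_ofMat`. The entries lie in a module, so a linear form `J` into the ring is
applied to express the compression as a matrix product. -/
theorem apply_tmat_ofTmat (J : I →ₗ[A] A) (K : Matrix ι κ I) :
    (b.tmat c (b.ofTmat c K)).map J =
      b.mat b LinearMap.id * K.map J * c.mat c LinearMap.id := by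
  ext i j
  simp only [map_apply, tmat_apply, ofTmat, LinearMap.sum_apply,
    LinearMap.smulRight_apply, map_sum, map_smul, tcoord_tmul, mul_apply, mat_apply,
    LinearMap.id_apply, smul_eq_mul, Finset.sum_mul, Finset.mul_sum]
  exact Finset.sum_congr rfl fun k _ => Finset.sum_congr rfl fun m _ => by ring

end Tensor

end DualGens

/-! ### Matrices of windows and of their morphisms -/

section WindowMatrices

variable {p : ℕ} {F G : Frame.{u} p}

/-- Generating systems of the two components of a finite projective `(𝒮, ℐ)`-module. -/
structure FilMod.Gens (P : FilMod F) (ι κ : Type*) [Fintype ι] [Fintype κ] where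
  T : DualGens F.A P.T ι
  L : DualGens F.A P.L κ

namespace FilMod.Gens

theorem exists_gens (P : FilMod F) : ∃ m n : ℕ, Nonempty (P.Gens (Fin m) (Fin n)) := by
  obtain ⟨m, ⟨bT⟩⟩ := DualGens.exists_of_projective F.A P.T
  obtain ⟨n, ⟨bL⟩⟩ := DualGens.exists_of_projective F.A P.L
  exact ⟨m, n, ⟨⟨bT, bL⟩⟩⟩

variable {P Q : FilMod F} {ι κ ι' κ' : Type*} [Fintype ι] [Fintype κ] [Fintype ι'] [Fintype κ']

/-- The induced generating system of `S ⊗ P`. -/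
def under (b : P.Gens ι κ) : DualGens F.S P.Under (ι ⊕ κ) := (b.T.bc F.proj).prod (b.L.bc F.proj)

/-- The induced generating system of `P^σ`. -/
def twist (b : P.Gens ι κ) : DualGens F.S P.Twist (ι ⊕ κ) := (b.T.bc F.sigma).prod (b.L.bc F.sigma)

/-- The induced generating systems of a base change. -/
def baseChange (b : P.Gens ι κ) (α : FrameHom F G) : (P.baseChange α).Gens ι κ :=
  ⟨b.T.bc α.onA, b.L.bc α.onA⟩

variable (b : P.Gens ι κ) (b' : Q.Gens ι' κ')

/-- The matrix of the entry `T → T'`. -/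
def aMat (f : FilMod.Hom P Q) : Matrix ι' ι F.A := b.T.mat b'.T f.a

/-- The matrix of the entry `L → ℐ ⊗ T'`. -/
def bMat (f : FilMod.Hom P Q) : Matrix ι' κ F.I := b'.T.tmat b.L f.b

/-- The matrix of the entry `T → L'`. -/
def cMat (f : FilMod.Hom P Q) : Matrix κ' ι F.A := b.T.mat b'.L f.c

/-- The matrix of the entry `L → L'`. -/
def dMat (f : FilMod.Hom P Q) : Matrix κ' κ F.A := b.L.mat b'.L f.d

theorem hom_ext {f g : FilMod.Hom P Q} (ha : aMat b b' f = aMat b b' g)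
    (hb : bMat b b' f = bMat b b' g) (hc : cMat b b' f = cMat b b' g)
    (hd : dMat b b' f = dMat b b' g) : f = g :=
  FilMod.Hom.ext (DualGens.mat_injective _ _ ha) (DualGens.tmat_injective _ _ hb)
    (DualGens.mat_injective _ _ hc) (DualGens.mat_injective _ _ hd)

theorem coord_bIncl {N : Type u} [AddCommGroup N] [Module F.A N] (c : DualGens F.A N ι) (i : ι)
    (x : F.I ⊗[F.A] N) :
    c.coord i (TensorProduct.lift ((LinearMap.lsmul F.A N).comp F.incl) x) =
      F.incl (c.tcoord i x) := by
  induction x using TensorProduct.induction_on with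
  | zero => simp
  | tmul y x => simp [mul_comm]
  | add x y hx hy => simp only [map_add, hx, hy]

theorem coord_divMap {N : Type u} [AddCommGroup N] [Module F.A N] (c : DualGens F.A N ι) (i : ι)
    (x : F.I ⊗[F.A] N) :
    (c.bc F.sigma).coord i (divMap F N x) = F.sigmaDiv (c.tcoord i x) := by
  induction x using TensorProduct.induction_on with
  | zero => simp
  | tmul y x => simp [divMap, map_smulₛₗ, mul_comm]
  | add x y hx hy => simp only [map_add, hx, hy]

theorem tcoord_onTensor {N : Type u} [AddCommGroup N] [Module F.A N] (α : FrameHom F G)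
    (c : DualGens F.A N ι) (i : ι) (x : F.I ⊗[F.A] N) :
    (c.bc α.onA).tcoord i (α.onTensor N x) = α.onI (c.tcoord i x) := by
  induction x using TensorProduct.induction_on with
  | zero => simp
  | tmul y x => simp [FrameHom.onTensor, map_smulₛₗ]
  | add x y hx hy => simp only [map_add, hx, hy]

theorem mat_under (f : FilMod.Hom P Q) :
    b.under.mat b'.under f.under =
      fromBlocks ((aMat b b' f).map F.proj) (((bMat b b' f).map F.incl).map F.proj)
        ((cMat b b' f).map F.proj) ((dMat b b' f).map F.proj) := by
  rw [under, under, FilMod.Hom.under, DualGens.mat_prod_coprod, DualGens.mat_bc_map,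
    DualGens.mat_bc_map, DualGens.mat_bc_map, DualGens.mat_bc_map]
  have h : b.L.mat b'.T (bIncl f.b) = (bMat b b' f).map F.incl := by
    ext i j
    rw [map_apply, bMat, DualGens.tmat_apply, ← coord_bIncl]
    rfl
  rw [h]
  rfl

theorem mat_twist (f : FilMod.Hom P Q) :
    b.twist.mat b'.twist f.twist =
      fromBlocks ((aMat b b' f).map F.sigma) ((bMat b b' f).map F.sigmaDiv)
        (p • (cMat b b' f).map F.sigma) ((dMat b b' f).map F.sigma) := by
  rw [twist, twist, FilMod.Hom.twist, DualGens.mat_prod_coprod, DualGens.mat_bc_map,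
    DualGens.mat_nsmul, DualGens.mat_bc_map, DualGens.mat_bc_map]
  have h : (b.L.bc F.sigma).mat (b'.T.bc F.sigma) (bDiv f.b) =
      (bMat b b' f).map F.sigmaDiv := by
    ext i j
    rw [map_apply, bMat, DualGens.tmat_apply, ← coord_divMap, DualGens.mat_apply,
      DualGens.bc_vec]
    simp [bDiv]
  rw [h]
  rfl

theorem twistEquiv_vec (α : FrameHom F G) (j : ι ⊕ κ) :
    P.twistEquiv α ((b.baseChange α).twist.vec j) = BC.of α.onS (b.twist.vec j) := by
  rcases j with j | j <;>
    simp [twistEquiv, twist, baseChange, DualGens.prod, DualGens.bc_vec]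

theorem underEquiv_vec (α : FrameHom F G) (j : ι ⊕ κ) :
    P.underEquiv α ((b.baseChange α).under.vec j) = BC.of α.onS (b.under.vec j) := by
  rcases j with j | j <;>
    simp [underEquiv, under, baseChange, DualGens.prod, DualGens.bc_vec]

theorem mat_under_id_baseChange (α : FrameHom F G) :
    (b.baseChange α).under.mat (b.baseChange α).under LinearMap.id =
      (b.under.mat b.under LinearMap.id).map α.onS := by
  have h : ∀ x, G.proj (α.onA x) = α.onS (F.proj x) := RingHom.congr_fun α.proj_comm
  rw [under, under, DualGens.mat_prod_id, DualGens.mat_prod_id, fromBlocks_map, baseChange,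
    DualGens.mat_bc_id, DualGens.mat_bc_id, DualGens.mat_bc_id, DualGens.mat_bc_id,
    DualGens.mat_bc_id, DualGens.mat_bc_id]
  ext (i | i) (j | j) <;> simp [h]

theorem mat_twist_id_baseChange (α : FrameHom F G) :
    (b.baseChange α).twist.mat (b.baseChange α).twist LinearMap.id =
      (b.twist.mat b.twist LinearMap.id).map α.onS := by
  have h : ∀ x, G.sigma (α.onA x) = α.onS (F.sigma x) := RingHom.congr_fun α.sigma_comm
  rw [twist, twist, DualGens.mat_prod_id, DualGens.mat_prod_id, fromBlocks_map, baseChange,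
    DualGens.mat_bc_id, DualGens.mat_bc_id, DualGens.mat_bc_id, DualGens.mat_bc_id,
    DualGens.mat_bc_id, DualGens.mat_bc_id]
  ext (i | i) (j | j) <;> simp [h]

theorem bMat_baseChange (α : FrameHom F G) (f : FilMod.Hom P Q) :
    bMat (b.baseChange α) (b'.baseChange α) (f.baseChange α) = (bMat b b' f).map α.onI := by
  ext i j
  rw [map_apply, bMat, bMat, DualGens.tmat_apply, DualGens.tmat_apply, ← tcoord_onTensor]
  simp [baseChange, FilMod.Hom.baseChange, DualGens.bc_vec]

end FilMod.Gens

/-! ### Matrices of `Ψ` and `Ψ⁻¹`, and compatibility with `Ψ` -/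

namespace Window

variable {P Q : Window F} {ι κ ι' κ' : Type*} [Fintype ι] [Fintype κ] [Fintype ι'] [Fintype κ']

/-- The matrix of `Ψ`. -/
def psiMat (P : Window F) (b : P.Gens ι κ) : Matrix (ι ⊕ κ) (ι ⊕ κ) F.S :=
  b.twist.mat b.under P.Psi.toLinearMap

/-- The matrix of `Ψ⁻¹`. -/
def psiInvMat (P : Window F) (b : P.Gens ι κ) : Matrix (ι ⊕ κ) (ι ⊕ κ) F.S :=
  b.under.mat b.twist P.Psi.symm.toLinearMap

theorem psiMat_mul_psiInvMat (b : P.Gens ι κ) :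
    P.psiMat b * P.psiInvMat b = b.under.mat b.under LinearMap.id := by
  rw [psiMat, psiInvMat, ← DualGens.mat_comp]
  congr 1
  exact LinearMap.ext fun x => by simp

theorem psiInvMat_mul_psiMat (b : P.Gens ι κ) :
    P.psiInvMat b * P.psiMat b = b.twist.mat b.twist LinearMap.id := by
  rw [psiMat, psiInvMat, ← DualGens.mat_comp]
  congr 1
  exact LinearMap.ext fun x => by simp

/-- The matrices of `Ψ` and `Ψ⁻¹` are inverse only up to `ε`, which suffices because the matrix of
any linear map absorbs `ε`. -/
theorem comm_iff_mat (b : P.Gens ι κ) (b' : Q.Gens ι' κ')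
    (f : FilMod.Hom P.toFilMod Q.toFilMod) :
    (∀ x, f.under (P.Psi x) = Q.Psi (f.twist x)) ↔
      b.under.mat b'.under f.under =
        Q.psiMat b' * b.twist.mat b'.twist f.twist * P.psiInvMat b := by
  have h : (∀ x, f.under (P.Psi x) = Q.Psi (f.twist x)) ↔
      b.twist.mat b'.under (f.under ∘ₗ P.Psi.toLinearMap) =
        b.twist.mat b'.under (Q.Psi.toLinearMap ∘ₗ f.twist) := by
    rw [(DualGens.mat_injective _ _).eq_iff]
    exact ⟨fun h => LinearMap.ext h, fun h x => LinearMap.congr_fun h x⟩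
  rw [h, DualGens.mat_comp _ b.under, DualGens.mat_comp _ b'.twist, ← psiMat, ← psiMat]
  constructor
  · intro e
    rw [← e, Matrix.mul_assoc, psiMat_mul_psiInvMat, DualGens.mat_mul_id]
  · intro e
    rw [e, Matrix.mul_assoc, psiInvMat_mul_psiMat, Matrix.mul_assoc, DualGens.mat_mul_id]

/-- The comparison isomorphisms match the base-changed generators with the images of the old ones.
This gives the matrix up to a factor `ε`, which the image of the old matrix already absorbs. -/
theorem psiMat_baseChange (α : FrameHom F G) (b : P.Gens ι κ) :
    (P.baseChange α).psiMat (b.baseChange α) = (P.psiMat b).map α.onS := by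
  rw [psiMat, DualGens.mat_eq_of_apply_vec (K := (P.psiMat b).map α.onS),
    FilMod.Gens.mat_under_id_baseChange, ← Matrix.map_mul, psiMat, DualGens.id_mul_mat]
  intro j
  apply (P.toFilMod.underEquiv α).injective
  have h : P.underEquiv α ((P.baseChange α).Psi ((b.baseChange α).twist.vec j)) =
      BC.congr α.onS P.Psi (P.twistEquiv α ((b.baseChange α).twist.vec j)) :=
    LinearEquiv.apply_symm_apply _ _
  refine h.trans ?_
  rw [FilMod.Gens.twistEquiv_vec, BC.congr_of, map_sum]
  have h2 := b.twist.apply_vec b.under P.Psi.toLinearMap j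
  rw [LinearEquiv.coe_coe] at h2
  rw [h2, map_sum]
  refine Finset.sum_congr rfl fun i _ => ?_
  rw [map_smulₛₗ, map_smul, FilMod.Gens.underEquiv_vec]
  rfl

theorem psiInvMat_baseChange (α : FrameHom F G) (b : P.Gens ι κ) :
    (P.baseChange α).psiInvMat (b.baseChange α) = (P.psiInvMat b).map α.onS := by
  rw [psiInvMat, DualGens.mat_eq_of_apply_vec (K := (P.psiInvMat b).map α.onS),
    FilMod.Gens.mat_twist_id_baseChange, ← Matrix.map_mul, psiInvMat, DualGens.id_mul_mat]
  intro j
  apply (P.toFilMod.twistEquiv α).injective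
  have h : P.twistEquiv α ((P.baseChange α).Psi.symm ((b.baseChange α).under.vec j)) =
      (BC.congr α.onS P.Psi).symm (P.underEquiv α ((b.baseChange α).under.vec j)) :=
    LinearEquiv.apply_symm_apply _ _
  refine h.trans ?_
  rw [FilMod.Gens.underEquiv_vec, map_sum, LinearEquiv.symm_apply_eq, map_sum]
  have h2 := b.under.apply_vec b.twist P.Psi.symm.toLinearMap j
  rw [LinearEquiv.coe_coe, LinearEquiv.symm_apply_eq, map_sum] at h2
  rw [h2, map_sum]
  refine Finset.sum_congr rfl fun i _ => ?_
  rw [map_smul, map_smulₛₗ, map_smul, map_smul, FilMod.Gens.twistEquiv_vec, BC.congr_of]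
  rfl

end Window

end WindowMatrices

end Displays

end

noncomputable section

namespace Displays

open WittVector Matrix

/-! ### Nilpotence in terms of matrices -/

section Nilpotence

/-- The matrix of the component `S ⊗ L → L^σ` of `Ψ⁻¹`. -/
def Window.zMat {p : ℕ} {F : Frame.{u} p} {ι κ : Type*} [Fintype ι] [Fintype κ]
    (P : Window F) (b : P.Gens ι κ) : Matrix κ κ F.S := (P.psiInvMat b).toBlocks₂₂

theorem Window.zMat_eq {p : ℕ} {F : Frame.{u} p} {ι κ : Type*} [Fintype ι] [Fintype κ]
    (P : Window F) (b : P.Gens ι κ) :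
    P.zMat b = (b.L.bc F.proj).mat (b.L.bc F.sigma) P.zBreve := rfl

theorem Window.zBar_vec {p : ℕ} {F : Frame.{u} p} {ι κ : Type*} [Fintype ι] [Fintype κ]
    (P : Window F) (b : P.Gens ι κ) {k : Type u} [CommRing k] (χ : F.A →+* k)
    (χS : F.S →+* k) (hχ : χS.comp F.proj = χ) (φ : k →+* k) (hφ : χS.comp F.sigma = φ.comp χ)
    (j : κ) : P.zBar χ χS hχ φ hφ ((b.L.bc χ).vec j) =
      ∑ i, (P.zMat b).map χS i j • BC.of φ ((b.L.bc χ).vec i) := by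
  have h := (b.L.bc F.proj).apply_vec (b.L.bc F.sigma) P.zBreve j
  rw [← Window.zMat_eq] at h
  simp only [Window.zBar, LinearMap.comp_apply, DualGens.bc_vec, LinearEquiv.coe_coe,
    BC.compEquiv_symm_of, BC.map_of] at h ⊢
  rw [h, map_sum, map_sum]
  refine Finset.sum_congr rfl fun i _ => ?_
  rw [map_smulₛₗ, map_smul, BC.swap_of, map_apply]

/-- The product `φ^{m - 1}(Z) ⋯ φ(Z) Z`. -/
def twistProd {k : Type*} [CommRing k] {κ : Type*} [Fintype κ] [DecidableEq κ] (φ : k →+* k)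
    (Z : Matrix κ κ k) : ℕ → Matrix κ κ k
  | 0 => 1
  | m + 1 => Z.map (φ ^ m : k →+* k) * twistProd φ Z m

variable {κ : Type*} [Fintype κ] [DecidableEq κ]

theorem iterTwist_vec {k : Type u} [CommRing k] (φ : k →+* k) {N : Type u} [AddCommGroup N]
    [Module k N] (z : N →ₗ[k] BC φ N) (v : κ → N) (Z : Matrix κ κ k)
    (hz : ∀ j, z (v j) = ∑ i, Z i j • BC.of φ (v i)) (m : ℕ) (j : κ) :
    iterTwist φ z m (v j) = ∑ i, twistProd φ Z m i j • BC.of (φ ^ m) (v i) := by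
  induction m with
  | zero =>
    simp only [twistProd, one_apply, ite_smul, one_smul, zero_smul, Finset.sum_ite_eq',
      Finset.mem_univ, if_true]
    rfl
  | succ m ih =>
    simp only [iterTwist, LinearMap.comp_apply, ih, map_sum, map_smul, BC.map_of, hz,
      map_smulₛₗ, LinearEquiv.coe_coe, BC.compEquiv_of, twistProd, mul_apply, map_apply,
      Finset.sum_smul, Finset.smul_sum]
    rw [Finset.sum_comm]
    refine Finset.sum_congr rfl fun i _ => Finset.sum_congr rfl fun l _ => ?_
    rw [smul_smul, mul_comm]

/-- In redundant coordinates the vanishing of the `m`-fold composition only says that `φ^m(ε)` times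
the product is zero. One more factor `Z = Z ε` absorbs the idempotent, whence `m + 1`. -/
theorem twistProd_succ_eq_zero {k : Type u} [CommRing k] (φ : k →+* k) {N : Type u}
    [AddCommGroup N] [Module k N] (b : DualGens k N κ) (z : N →ₗ[k] BC φ N) (Z : Matrix κ κ k)
    (hz : ∀ j, z (b.vec j) = ∑ i, Z i j • BC.of φ (b.vec i))
    (hZ : Z * b.mat b LinearMap.id = Z) (m : ℕ) (h : iterTwist φ z m = 0) :
    twistProd φ Z (m + 1) = 0 := by
  have h0 : (b.mat b LinearMap.id).map (φ ^ m : k →+* k) * twistProd φ Z m = 0 := by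
    ext i j
    have h1 := congrArg ((b.bc (φ ^ m)).coord i) (iterTwist_vec φ z b.vec Z hz m j)
    rw [h, LinearMap.zero_apply, map_zero, map_sum] at h1
    rw [mul_apply, Matrix.zero_apply, h1]
    refine Finset.sum_congr rfl fun l _ => ?_
    rw [map_smul, DualGens.bc_coord_of, smul_eq_mul, mul_comm]
    rfl
  rw [twistProd, ← hZ, Matrix.map_mul, hZ, Matrix.mul_assoc, h0, Matrix.mul_zero]

variable {p : ℕ} {F : Frame.{u} p} {ι : Type*} [Fintype ι]

theorem Window.twistProd_zMat (P : Window F) (b : P.Gens ι κ) {k : Type u} [CommRing k]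
    (χ : F.A →+* k) (χS : F.S →+* k) (hχ : χS.comp F.proj = χ) (φ : k →+* k)
    (hφ : χS.comp F.sigma = φ.comp χ) (m : ℕ) (h : iterTwist φ (P.zBar χ χS hχ φ hφ) m = 0) :
    twistProd φ ((P.zMat b).map χS) (m + 1) = 0 := by
  refine twistProd_succ_eq_zero φ (b.L.bc χ) _ _ (P.zBar_vec b χ χS hχ φ hφ) ?_ m h
  have h1 := (b.L.bc F.proj).mat_mul_id (b.L.bc F.sigma) P.zBreve
  rw [← Window.zMat_eq, DualGens.mat_bc_id] at h1
  conv_rhs => rw [← h1]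
  rw [Matrix.map_mul, Matrix.map_map, DualGens.mat_bc_id, ← hχ]
  rfl

variable [hp : Fact p.Prime] {R : Type u} [CommRing R] {hR : IsNilpotent (p : R)}

theorem residue_eq_zero_iff {x : WittVector p R} :
    residue p R x = 0 ↔ ∃ t, x.coeff 0 = p * t := by
  change Ideal.Quotient.mk _ (x.coeff 0) = 0 ↔ _
  rw [Ideal.Quotient.eq_zero_iff_mem, Ideal.mem_span_singleton']
  exact exists_congr fun t => by rw [eq_comm, mul_comm]

theorem residue_iterate_frobenius (m : ℕ) (x : WittVector p R) :
    residue p R (frobenius^[m] x) =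
      (frob p (ModP p R) (modP_eq_zero p R) ^ m : ModP p R →+* ModP p R) (residue p R x) := by
  induction m with
  | zero => rfl
  | succ m ih =>
    rw [Function.iterate_succ_apply', pow_succ', RingHom.mul_def, RingHom.comp_apply, ← ih]
    exact RingHom.congr_fun (residue_frobenius p R) _

/-- The two products have their twists in opposite order, which the transposes reconcile. -/
theorem twistProd_residue (Z : Matrix κ κ (WittVector p R)) (m : ℕ) :
    twistProd (frob p (ModP p R) (modP_eq_zero p R)) (Z.map (residue p R)) m =
      ((frobProd Zᵀ m)ᵀ).map (residue p R) := by
  induction m with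
  | zero => simp [twistProd, frobProd]
  | succ m ih =>
    rw [twistProd, ih, frobProd_succ', transpose_mul, Matrix.map_mul]
    congr 1
    ext i j
    simp only [map_apply, transpose_apply, frobTwist, residue_iterate_frobenius]

theorem Display.IsNilpotentOfOrderLE.frobProd_coeff_zero {P : Display p R hR} {e : ℕ}
    (h : P.IsNilpotentOfOrderLE e) (b : P.Gens ι κ) (i j : κ) :
    ∃ t, (frobProd (Window.zMat P b)ᵀ (e + 1) i j).coeff 0 = p * t := by
  rw [← residue_eq_zero_iff]
  have h0 := Window.twistProd_zMat P b (residue p R) (residue p R) rfl _ (residue_frobenius p R) e h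
  have h2 := twistProd_residue (Window.zMat P b) (e + 1)
  rw [h0] at h2
  exact (congrFun (congrFun h2 j) i).symm

end Nilpotence

/-! ### The semilinear system of morphisms of displays -/

section MatSystem

variable {p : ℕ} [hp : Fact p.Prime] {R : Type u} [CommRing R]
variable {ι κ ι' κ' : Type*}

/-- A matrix as a vector. -/
def vecOf {A : Type*} (U : Matrix ι κ A) : ι × κ → A := fun x => U x.1 x.2

theorem vecOf_eq_zero_iff {A : Type*} [Zero A] {U : Matrix ι κ A} : vecOf U = 0 ↔ U = 0 :=
  ⟨fun h => by ext i j; exact congrFun h (i, j), fun h => by rw [h]; rfl⟩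

/-- The matrix of the map on Frobenius twists. -/
def twMat (U : Matrix (ι' ⊕ κ') (ι ⊕ κ) (WittVector p R)) (B : Matrix ι' κ (WittVector p R)) :
    Matrix (ι' ⊕ κ') (ι ⊕ κ) (WittVector p R) :=
  fromBlocks (U.toBlocks₁₁.map frobenius) B (p • U.toBlocks₂₁.map frobenius)
    (U.toBlocks₂₂.map frobenius)

variable (p R ι κ ι' κ') in
/-- The coefficients of the Frobenius in `twMat`. -/
def twWeight : Matrix (ι' ⊕ κ') (ι ⊕ κ) (WittVector p R) :=
  fromBlocks (Matrix.of fun _ _ => 1) 0 (Matrix.of fun _ _ => (p : WittVector p R))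
    (Matrix.of fun _ _ => 1)

/-- Putting the factor `p` of the lower left block into a weight makes `tw` linear in `F(U)` and
`B`, so that the coefficients of the system can be read off. -/
theorem twMat_eq (U : Matrix (ι' ⊕ κ') (ι ⊕ κ) (WittVector p R))
    (B : Matrix ι' κ (WittVector p R)) (k : ι' ⊕ κ') (l : ι ⊕ κ) :
    twMat U B k l = twWeight p R ι κ ι' κ' k l * frobenius (U k l) + fromBlocks 0 B 0 0 k l := by
  rcases k with k | k <;> rcases l with l | l <;>
    simp [twMat, twWeight, toBlocks₁₁, toBlocks₂₁, toBlocks₂₂]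

variable (M : Matrix (ι' ⊕ κ') (ι' ⊕ κ') (WittVector p R))
  (N : Matrix (ι ⊕ κ) (ι ⊕ κ) (WittVector p R))

/-- The system `U = M · twMat U B · N`, `V(B) = (M · twMat U B · N)₁₂`. -/
def matSystem : WittSystem p R ((ι' ⊕ κ') × (ι ⊕ κ)) (ι' × κ) where
  L₁ := Matrix.of fun x y => M x.1 y.1 * twWeight p R ι κ ι' κ' y.1 y.2 * N y.2 x.2
  L₂ := Matrix.of fun x y => M x.1 (Sum.inl y.1) * N (Sum.inr y.2) x.2
  L₃ := Matrix.of fun x y =>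
    M (Sum.inl x.1) y.1 * twWeight p R ι κ ι' κ' y.1 y.2 * N y.2 (Sum.inr x.2)
  L₄ := kroneckerMap (· * ·) M.toBlocks₁₁ N.toBlocks₂₂ᵀ

section

variable [Fintype ι'] [Fintype κ] [DecidableEq ι'] [DecidableEq κ]

theorem frobProd_kronecker (K : Matrix ι' ι' (WittVector p R)) (L : Matrix κ κ (WittVector p R))
    (m : ℕ) : frobProd (kroneckerMap (· * ·) K L) m =
      kroneckerMap (· * ·) (frobProd K m) (frobProd L m) := by
  induction m with
  | zero => exact (one_kronecker_one).symm
  | succ m ih =>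
    rw [frobProd, ih, frobProd, frobProd, mul_kronecker_mul]
    congr 1
    ext x y : 1
    simp [kroneckerMap_apply]

/-- Twisted products of Kronecker products are formed factor by factor, and the zeroth component is
multiplicative; nilpotence of the factor from the source is enough. -/
theorem matSystem_frobProd_coeff_zero (m : ℕ)
    (h : ∀ i j, ∃ t, (frobProd N.toBlocks₂₂ᵀ m i j).coeff 0 = p * t) (x y : ι' × κ) :
    ∃ t, (frobProd (matSystem M N).L₄ m x y).coeff 0 = p * t := by
  obtain ⟨t, ht⟩ := h x.2 y.2
  refine ⟨(frobProd M.toBlocks₁₁ m x.1 y.1).coeff 0 * t, ?_⟩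
  rw [matSystem, frobProd_kronecker, kroneckerMap_apply, mul_coeff_zero, ht]
  ring

end

variable [Fintype ι] [Fintype κ] [Fintype ι'] [Fintype κ']

theorem matSystem_aux (U : Matrix (ι' ⊕ κ') (ι ⊕ κ) (WittVector p R))
    (B : Matrix ι' κ (WittVector p R)) (i : ι' ⊕ κ') (j : ι ⊕ κ) :
    ∑ y : (ι' ⊕ κ') × (ι ⊕ κ), M i y.1 * twWeight p R ι κ ι' κ' y.1 y.2 * N y.2 j *
        frobenius (U y.1 y.2) + ∑ y : ι' × κ, M i (Sum.inl y.1) * N (Sum.inr y.2) j * B y.1 y.2 =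
      (M * twMat U B * N) i j := by
  have h1 : (M * twMat U B * N) i j = ∑ k, ∑ l, M i k * twMat U B k l * N l j := by
    rw [mul_apply, Finset.sum_comm]
    refine Finset.sum_congr rfl fun l _ => ?_
    rw [mul_apply, Finset.sum_mul]
  have h2 : ∀ k l, M i k * twMat U B k l * N l j =
      M i k * twWeight p R ι κ ι' κ' k l * N l j * frobenius (U k l) +
        M i k * fromBlocks 0 B 0 0 k l * N l j := fun k l => by rw [twMat_eq]; ring
  simp only [h1, h2, Finset.sum_add_distrib, Fintype.sum_prod_type]
  congr 1
  simp [Fintype.sum_sum_type, mul_right_comm]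

theorem matSystem_defect₁ (U : Matrix (ι' ⊕ κ') (ι ⊕ κ) (WittVector p R))
    (B : Matrix ι' κ (WittVector p R)) :
    (matSystem M N).defect₁ (vecOf U) (vecOf B) = vecOf (U - M * twMat U B * N) := by
  funext x
  rw [WittSystem.defect₁, sub_sub]
  change _ = U x.1 x.2 - (M * twMat U B * N) x.1 x.2
  rw [← matSystem_aux]
  rfl

theorem matSystem_defect₂ (U : Matrix (ι' ⊕ κ') (ι ⊕ κ) (WittVector p R))
    (B : Matrix ι' κ (WittVector p R)) :
    (matSystem M N).defect₂ (vecOf U) (vecOf B) =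
      vecOf (B.map verschiebung - (M * twMat U B * N).toBlocks₁₂) := by
  funext x
  rw [WittSystem.defect₂, sub_sub]
  change _ = verschiebung (B x.1 x.2) - (M * twMat U B * N) (Sum.inl x.1) (Sum.inr x.2)
  rw [← matSystem_aux]
  rfl

/-- The second equation of the system equates `V(B)` with a block of `M · tw · N`; once the first
one holds, this is the corresponding block of `U`. -/
theorem matSystem_isSol (U : Matrix (ι' ⊕ κ') (ι ⊕ κ) (WittVector p R))
    (B : Matrix ι' κ (WittVector p R)) :
    (matSystem M N).IsSol (vecOf U) (vecOf B) ↔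
      U = M * twMat U B * N ∧ B.map verschiebung = U.toBlocks₁₂ := by
  rw [WittSystem.IsSol, matSystem_defect₁, matSystem_defect₂, vecOf_eq_zero_iff,
    vecOf_eq_zero_iff, sub_eq_zero, sub_eq_zero]
  constructor
  · rintro ⟨h1, h2⟩
    exact ⟨h1, h2.trans (congrArg toBlocks₁₂ h1.symm)⟩
  · rintro ⟨h1, h2⟩
    exact ⟨h1, h2.trans (congrArg toBlocks₁₂ h1)⟩

end MatSystem

/-! ### Base change and lifting of homomorphisms -/

namespace DualGens

section

variable {A : Type*} [CommRing A] {I X Y : Type*} [AddCommGroup I] [Module A I]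
  [AddCommGroup X] [Module A X] [AddCommGroup Y] [Module A Y]
  {ι κ : Type*} [Fintype ι] [Fintype κ] (b : DualGens A X ι) (c : DualGens A Y κ)

theorem ofMat_mat (φ : X →ₗ[A] Y) : b.ofMat c (b.mat c φ) = φ := by
  apply b.mat_injective c
  rw [mat_ofMat, id_mul_mat, mat_mul_id]

theorem ofTmat_tmat (φ : Y →ₗ[A] I ⊗[A] X) : b.ofTmat c (b.tmat c φ) = φ := by
  ext y
  conv_rhs => rw [← c.sum_coord y, map_sum]
  simp only [ofTmat, LinearMap.sum_apply, LinearMap.smulRight_apply, map_smul]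
  refine Finset.sum_congr rfl fun j _ => ?_
  rw [← b.sum_tcoord (φ (c.vec j))]
  rfl

theorem tmat_nsmul (n : ℕ) (φ : Y →ₗ[A] I ⊗[A] X) : b.tmat c (n • φ) = n • b.tmat c φ := by
  ext i j
  simp [tmat_apply]

end

theorem bc_map_ofMat {A B : Type u} [CommRing A] [CommRing B] {X Y : Type u} [AddCommGroup X]
    [Module A X] [AddCommGroup Y] [Module A Y] {ι κ : Type*} [Fintype ι] [Fintype κ]
    (f : A →+* B) (b : DualGens A X ι) (c : DualGens A Y κ) (K : Matrix κ ι A) :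
    BC.map f (b.ofMat c K) = (b.bc f).ofMat (c.bc f) (K.map f) := by
  apply (b.bc f).mat_injective (c.bc f)
  rw [mat_bc_map, mat_ofMat, mat_ofMat, mat_bc_id, mat_bc_id, Matrix.map_mul, Matrix.map_mul]

end DualGens

section BaseChangeHom

variable {p : ℕ} {F G : Frame.{u} p} {P Q : FilMod F}

theorem BC.map_nsmul {A B : Type u} [CommRing A] [CommRing B] {X Y : Type u} [AddCommGroup X]
    [Module A X] [AddCommGroup Y] [Module A Y] (f : A →+* B) (n : ℕ) (φ : X →ₗ[A] Y) :
    BC.map f (n • φ) = n • BC.map f φ :=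
  BC.hom_ext fun m => by simp

theorem FilMod.Hom.baseChange_nsmul (α : FrameHom F G) (n : ℕ) (f : FilMod.Hom P Q) :
    (n • f).baseChange α = n • f.baseChange α := by
  refine FilMod.Hom.ext (BC.map_nsmul _ _ _) ?_ (BC.map_nsmul _ _ _) (BC.map_nsmul _ _ _)
  refine BC.hom_ext fun m => ?_
  change BC.lift ((α.onTensor Q.T).comp (n • f.b)) (BC.of α.onA m) =
    n • BC.lift ((α.onTensor Q.T).comp f.b) (BC.of α.onA m)
  rw [BC.lift_of, BC.lift_of]
  exact map_nsmul (α.onTensor Q.T) n (f.b m)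

/-- Matrix entries are lifted arbitrarily. The lifted matrices need not absorb `ε`, but `ofMat` and
`ofTmat` accept any matrix, commute with base change and recover a map from its matrix. -/
theorem FilMod.Hom.exists_baseChange_eq (α : FrameHom F G) (hA : Function.Surjective α.onA)
    (hI : Function.Surjective α.onI) (g : FilMod.Hom (P.baseChange α) (Q.baseChange α)) :
    ∃ f : FilMod.Hom P Q, f.baseChange α = g := by
  obtain ⟨m, n, ⟨b⟩⟩ := FilMod.Gens.exists_gens P
  obtain ⟨m', n', ⟨b'⟩⟩ := FilMod.Gens.exists_gens Q
  choose lA hlA using hA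
  choose lI hlI using hI
  have key : ∀ {X Y : Type u} [AddCommGroup X] [Module F.A X] [AddCommGroup Y] [Module F.A Y]
      {k l : ℕ} (c : DualGens F.A X (Fin k)) (d : DualGens F.A Y (Fin l))
      (φ : BC α.onA X →ₗ[G.A] BC α.onA Y), BC.map α.onA
        (c.ofMat d (((c.bc α.onA).mat (d.bc α.onA) φ).map lA)) = φ := by
    intro X Y _ _ _ _ k l c d φ
    rw [DualGens.bc_map_ofMat, Matrix.map_map]
    have : ((c.bc α.onA).mat (d.bc α.onA) φ).map (α.onA ∘ lA) =
        (c.bc α.onA).mat (d.bc α.onA) φ := by ext; simp [hlA]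
    rw [this, DualGens.ofMat_mat]
  refine ⟨⟨_, b'.T.ofTmat b.L (((b'.T.bc α.onA).tmat (b.L.bc α.onA) g.b).map lI), _, _⟩,
    FilMod.Hom.ext (key b.T b'.T g.a) ?_ (key b.T b'.L g.c) (key b.L b'.L g.d)⟩
  refine Eq.trans ?_ ((b'.T.bc α.onA).ofTmat_tmat (b.L.bc α.onA) g.b)
  refine BC.hom_ext fun y => ?_
  change BC.lift _ (BC.of α.onA y) = _
  rw [BC.lift_of]
  simp [DualGens.ofTmat, FrameHom.onTensor, map_smulₛₗ, hlI, DualGens.bc_vec]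

namespace FilMod.Gens

variable {ι κ ι' κ' : Type*} [Fintype ι] [Fintype κ] [Fintype ι'] [Fintype κ']
variable (b : P.Gens ι κ) (b' : Q.Gens ι' κ')

theorem mat_under_baseChange (α : FrameHom F G) (f : FilMod.Hom P Q) :
    (b.baseChange α).under.mat (b'.baseChange α).under (f.baseChange α).under =
      (b.under.mat b'.under f.under).map α.onS := by
  have h : ∀ x, G.proj (α.onA x) = α.onS (F.proj x) := RingHom.congr_fun α.proj_comm
  rw [mat_under, mat_under, bMat_baseChange, fromBlocks_map]
  simp only [baseChange, aMat, cMat, dMat, FilMod.Hom.baseChange, DualGens.mat_bc_map, Matrix.map_map,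
    Function.comp_def, h, α.incl_comm]

theorem mat_twist_baseChange (α : FrameHom F G) (f : FilMod.Hom P Q) :
    (b.baseChange α).twist.mat (b'.baseChange α).twist (f.baseChange α).twist =
      (b.twist.mat b'.twist f.twist).map α.onS := by
  have h : ∀ x, G.sigma (α.onA x) = α.onS (F.sigma x) := RingHom.congr_fun α.sigma_comm
  rw [mat_twist, mat_twist, bMat_baseChange, fromBlocks_map]
  simp only [baseChange, aMat, cMat, dMat, FilMod.Hom.baseChange, DualGens.mat_bc_map, Matrix.map_map,
    Function.comp_def, h, α.sigmaDiv_comm]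
  congr 1
  ext i j
  simp

theorem bMat_nsmul (n : ℕ) (f : FilMod.Hom P Q) : bMat b b' (n • f) = n • bMat b b' f :=
  DualGens.tmat_nsmul _ _ n f.b

theorem mat_under_nsmul (n : ℕ) (f : FilMod.Hom P Q) :
    b.under.mat b'.under (n • f).under = n • b.under.mat b'.under f.under := by
  have ha : aMat b b' (n • f) = n • aMat b b' f := DualGens.mat_nsmul _ _ n f.a
  have hc : cMat b b' (n • f) = n • cMat b b' f := DualGens.mat_nsmul _ _ n f.c
  have hd : dMat b b' (n • f) = n • dMat b b' f := DualGens.mat_nsmul _ _ n f.d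
  rw [mat_under, mat_under, fromBlocks_smul, ha, hc, hd, bMat_nsmul]
  congr 1 <;> ext i j <;> simp

/-- The homomorphism with given matrices. -/
def ofMats (A : Matrix ι' ι F.A) (B : Matrix ι' κ F.I) (C : Matrix κ' ι F.A)
    (D : Matrix κ' κ F.A) : FilMod.Hom P Q :=
  ⟨b.T.ofMat b'.T A, b'.T.ofTmat b.L B, b.T.ofMat b'.L C, b.L.ofMat b'.L D⟩

theorem mat_under_ofMats (A : Matrix ι' ι F.A) (B : Matrix ι' κ F.I) (C : Matrix κ' ι F.A)
    (D : Matrix κ' κ F.A) :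
    b.under.mat b'.under (ofMats b b' A B C D).under = b'.under.mat b'.under LinearMap.id *
      fromBlocks (A.map F.proj) ((B.map F.incl).map F.proj) (C.map F.proj) (D.map F.proj) *
        b.under.mat b.under LinearMap.id := by
  rw [mat_under, under, under, DualGens.mat_prod_id, DualGens.mat_prod_id, DualGens.mat_bc_id,
    DualGens.mat_bc_id, DualGens.mat_bc_id, DualGens.mat_bc_id, fromBlocks_multiply,
    fromBlocks_multiply]
  simp only [aMat, bMat, cMat, dMat, ofMats, DualGens.mat_ofMat, DualGens.apply_tmat_ofTmat,
    Matrix.map_mul, Matrix.zero_mul, Matrix.mul_zero, add_zero, zero_add]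

end FilMod.Gens

end BaseChangeHom

/-! ### Matrices of morphisms of displays -/

namespace Display

variable {p : ℕ} [hp : Fact p.Prime] {R : Type u} [CommRing R] {hR : IsNilpotent (p : R)}
variable {P Q : Display p R hR} {ι κ ι' κ' : Type*} [Fintype ι] [Fintype κ] [Fintype ι']
  [Fintype κ'] (b : P.Gens ι κ) (b' : Q.Gens ι' κ')

/-- The matrix of a homomorphism. -/
def homMat (f : FilMod.Hom P.toFilMod Q.toFilMod) : Matrix (ι' ⊕ κ') (ι ⊕ κ) (WittVector p R) :=
  b.under.mat b'.under f.under

/-- The matrix of the divided upper right entry of a homomorphism. -/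
def divMat (f : FilMod.Hom P.toFilMod Q.toFilMod) : Matrix ι' κ (WittVector p R) :=
  (FilMod.Gens.bMat b b' f).map (wittFrame p R hR).sigmaDiv

theorem homMat_eq (f : FilMod.Hom P.toFilMod Q.toFilMod) :
    homMat b b' f = fromBlocks (FilMod.Gens.aMat b b' f)
      (Matrix.map (divMat b b' f) verschiebung) (FilMod.Gens.cMat b b' f)
      (FilMod.Gens.dMat b b' f) := by
  have h : ((FilMod.Gens.bMat b b' f).map (wittFrame p R hR).incl).map (wittFrame p R hR).proj =
      (divMat b b' f).map verschiebung := by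
    ext i j : 1
    exact (verschiebung_sigmaDiv p R hR _).symm
  rw [← h]
  exact FilMod.Gens.mat_under b b' f

theorem divMat_map_verschiebung (f : FilMod.Hom P.toFilMod Q.toFilMod) :
    (divMat b b' f).map verschiebung = (homMat b b' f).toBlocks₁₂ := by
  rw [homMat_eq, toBlocks_fromBlocks₁₂]

theorem mat_twist_eq (f : FilMod.Hom P.toFilMod Q.toFilMod) :
    b.twist.mat b'.twist f.twist = twMat (homMat b b' f) (divMat b b' f) := by
  rw [homMat_eq]
  exact FilMod.Gens.mat_twist b b' f

theorem comm_iff_isSol (f : FilMod.Hom P.toFilMod Q.toFilMod) :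
    (∀ x, f.under (P.Psi x) = Q.Psi (f.twist x)) ↔
      (matSystem (p := p) (R := R) (Window.psiMat Q b') (Window.psiInvMat P b)).IsSol
        (vecOf (homMat b b' f)) (vecOf (divMat b b' f)) := by
  rw [Window.comm_iff_mat b b', mat_twist_eq, matSystem_isSol]
  exact (and_iff_left (divMat_map_verschiebung b b' f)).symm

theorem homMat_nsmul (n : ℕ) (f : FilMod.Hom P.toFilMod Q.toFilMod) :
    homMat b b' (n • f) = n • homMat b b' f :=
  FilMod.Gens.mat_under_nsmul b b' n f

theorem divMat_nsmul (n : ℕ) (f : FilMod.Hom P.toFilMod Q.toFilMod) :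
    divMat b b' (n • f) = n • divMat b b' f := by
  rw [divMat, FilMod.Gens.bMat_nsmul]
  ext i j : 1
  exact map_nsmul (wittFrame p R hR).sigmaDiv n _

/-- The entry `L → I_R ⊗ T'` is recovered from the upper right block because `V` is injective. -/
theorem homMat_injective :
    Function.Injective (homMat b b' : FilMod.Hom P.toFilMod Q.toFilMod → _) := by
  intro f g h
  have hdiv : divMat b b' f = divMat b b' g := by
    have h12 := congrArg toBlocks₁₂ h
    rw [← divMat_map_verschiebung, ← divMat_map_verschiebung] at h12
    ext i j : 1
    exact verschiebung_injective p R (congrFun (congrFun h12 i) j)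
  rw [homMat_eq, homMat_eq, fromBlocks_inj] at h
  refine FilMod.Gens.hom_ext b b' h.1 ?_ h.2.2.1 h.2.2.2
  ext i j : 1
  apply Subtype.ext
  have e := congrArg verschiebung (congrFun (congrFun hdiv i) j)
  exact (verschiebung_sigmaDiv p R hR _).symm.trans (e.trans (verschiebung_sigmaDiv p R hR _))

/-- A solution automatically absorbs the idempotents: `U = M · tw · N`, where `M` absorbs `ε` on the
left and `N` on the right. Hence `U` is the matrix of a homomorphism. -/
theorem exists_hom_of_isSol {U : Matrix (ι' ⊕ κ') (ι ⊕ κ) (WittVector p R)}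
    {B : Matrix ι' κ (WittVector p R)}
    (h : (matSystem (p := p) (R := R) (Window.psiMat Q b') (Window.psiInvMat P b)).IsSol
      (vecOf U) (vecOf B)) :
    ∃ g : Window.Hom P Q, homMat b b' g.toHom = U := by
  have h' := (matSystem_isSol _ _ _ _).mp h
  let K : Matrix ι' κ (wittFrame p R hR).I :=
    Matrix.of fun i j => ⟨verschiebung (B i j), verschiebung_coeff_zero (p := p) (B i j)⟩
  let g : FilMod.Hom P.toFilMod Q.toFilMod := FilMod.Gens.ofMats b b' (F := wittFrame p R hR)
    U.toBlocks₁₁ K U.toBlocks₂₁ U.toBlocks₂₂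
  let εP : Matrix (ι ⊕ κ) (ι ⊕ κ) (WittVector p R) := b.under.mat b.under LinearMap.id
  let εQ : Matrix (ι' ⊕ κ') (ι' ⊕ κ') (WittVector p R) := b'.under.mat b'.under LinearMap.id
  let M : Matrix (ι' ⊕ κ') (ι' ⊕ κ') (WittVector p R) := Window.psiMat Q b'
  let N : Matrix (ι ⊕ κ) (ι ⊕ κ) (WittVector p R) := Window.psiInvMat P b
  have hM : εQ * M = M := DualGens.id_mul_mat _ _ _
  have hN : N * εP = N := DualGens.mat_mul_id _ _ _
  have hg : homMat b b' g = U := by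
    have e : homMat b b' g = εQ * U * εP := by
      have hK : fromBlocks U.toBlocks₁₁ (B.map verschiebung) U.toBlocks₂₁ U.toBlocks₂₂ = U := by
        rw [h'.2, fromBlocks_toBlocks]
      rw [← hK]
      exact FilMod.Gens.mat_under_ofMats b b' (F := wittFrame p R hR) U.toBlocks₁₁ K
        U.toBlocks₂₁ U.toBlocks₂₂
    have hU : U = M * twMat U B * N := h'.1
    rw [e, hU, ← Matrix.mul_assoc, ← Matrix.mul_assoc, hM, Matrix.mul_assoc _ N, hN]
  refine ⟨⟨g, (comm_iff_isSol b b' g).mpr ?_⟩, hg⟩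
  have hB : divMat b b' g = B := by
    have e := divMat_map_verschiebung b b' g
    rw [hg, ← h'.2] at e
    ext i j : 1
    exact verschiebung_injective p R (congrFun (congrFun e i) j)
  rwa [hg, hB]

end Display

/-! ### Morphisms of truncated displays as approximate solutions -/

section Truncation

variable {p : ℕ} [hp : Fact p.Prime] {R : Type u} [CommRing R] {hR : IsNilpotent (p : R)}

theorem truncHom_onA_surjective (n : ℕ) (hR : IsNilpotent (p : R)) :
    Function.Surjective (truncHom p R n hR).onA :=
  Ideal.Quotient.mk_surjective.comp (WittVector.truncate_surjective p (n + 1) R)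

theorem truncHom_onI_surjective (n : ℕ) (hR : IsNilpotent (p : R)) :
    Function.Surjective (truncHom p R n hR).onI := by
  rintro ⟨x, hx⟩
  obtain ⟨X, rfl⟩ := WittVector.truncate_surjective p (n + 1) R x
  exact ⟨⟨X, mem_truncIdeal_iff.mp hx⟩, rfl⟩

namespace Display

variable {P Q : Display p R hR} {ι κ ι' κ' : Type*} [Fintype ι] [Fintype κ] [Fintype ι']
  [Fintype κ'] (b : P.Gens ι κ) (b' : Q.Gens ι' κ') (n : ℕ)

theorem sub_mem_wittFil_of_map_eq {α β : Type*} {K L : Matrix α β (WittVector p R)}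
    (h : K.map (WittVector.truncate n) = L.map (WittVector.truncate n)) :
    vecOf K - vecOf L ∈ vecIn (wittFil p R n) (α × β) :=
  mem_vecIn.mpr fun x => by
    change WittVector.truncate n (K x.1 x.2 - L x.1 x.2) = 0
    rw [map_sub, sub_eq_zero]
    exact congrFun (congrFun h x.1) x.2

theorem homMat_sub_mem {f g : FilMod.Hom P.toFilMod Q.toFilMod}
    (h : f.baseChange (truncHom p R n hR) = g.baseChange (truncHom p R n hR)) :
    vecOf (homMat b b' f) - vecOf (homMat b b' g) ∈ vecIn (wittFil p R n) _ := by
  apply sub_mem_wittFil_of_map_eq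
  have e := FilMod.Gens.mat_under_baseChange b b' (truncHom p R n hR) f
  rw [h, FilMod.Gens.mat_under_baseChange] at e
  exact e.symm

/-- `F^div` drops the zeroth of the `n + 1` components of an element of `I_{n+1,R}`, so `n`
components remain under control. -/
theorem divMat_sub_mem {f g : FilMod.Hom P.toFilMod Q.toFilMod}
    (h : f.baseChange (truncHom p R n hR) = g.baseChange (truncHom p R n hR)) :
    vecOf (divMat b b' f) - vecOf (divMat b b' g) ∈ vecIn (wittFil p R n) _ := by
  apply sub_mem_wittFil_of_map_eq
  have key : ∀ f : FilMod.Hom P.toFilMod Q.toFilMod,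
      (divMat b b' f).map (WittVector.truncate n) =
        (FilMod.Gens.bMat (b.baseChange _) (b'.baseChange _)
          (f.baseChange (truncHom p R n hR))).map (truncWittFrame p R n hR).sigmaDiv := fun f => by
    rw [FilMod.Gens.bMat_baseChange]
    ext i j : 1
    exact ((truncHom p R n hR).sigmaDiv_comm _).symm
  rw [key, key, h]

/-- Compatibility with `Ψ` after truncation is the matrix equation over `W_n(R)`, that is, the
system modulo `V^n`. -/
theorem defect_mem_of_comm {f : FilMod.Hom P.toFilMod Q.toFilMod}
    (h : ∀ x, (f.baseChange (truncHom p R n hR)).under ((Display.trunc P n).Psi x) =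
      (Display.trunc Q n).Psi ((f.baseChange (truncHom p R n hR)).twist x)) :
    (matSystem (p := p) (R := R) (Window.psiMat Q b') (Window.psiInvMat P b)).defect₁
        (vecOf (homMat b b' f)) (vecOf (divMat b b' f)) ∈ vecIn (wittFil p R n) _ ∧
      (matSystem (p := p) (R := R) (Window.psiMat Q b') (Window.psiInvMat P b)).defect₂
        (vecOf (homMat b b' f)) (vecOf (divMat b b' f)) ∈ vecIn (wittFil p R n) _ := by
  let M : Matrix (ι' ⊕ κ') (ι' ⊕ κ') (WittVector p R) := Window.psiMat Q b'
  let N : Matrix (ι ⊕ κ) (ι ⊕ κ) (WittVector p R) := Window.psiInvMat P b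
  have e := (Window.comm_iff_mat (P := Display.trunc P n) (Q := Display.trunc Q n)
    (b.baseChange _) (b'.baseChange _) _).mp h
  rw [FilMod.Gens.mat_under_baseChange, FilMod.Gens.mat_twist_baseChange,
    Window.psiMat_baseChange, Window.psiInvMat_baseChange, mat_twist_eq, ← Matrix.map_mul,
    ← Matrix.map_mul] at e
  have hd : vecOf (homMat b b' f) - vecOf (M * twMat (homMat b b' f) (divMat b b' f) * N) ∈
      vecIn (wittFil p R n) _ := sub_mem_wittFil_of_map_eq n e
  constructor
  · rw [matSystem_defect₁]
    exact hd
  · rw [matSystem_defect₂, divMat_map_verschiebung]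
    exact mem_vecIn.mpr fun x => mem_vecIn.mp hd (Sum.inl x.1, Sum.inr x.2)

end Display

end Truncation

end Displays

end

/-! ### The theorem -/

open Displays in
theorem mainTheorem8 (p : ℕ) [Fact p.Prime] (a e c : ℕ) :
    ∃ n : ℕ, 0 < n ∧
      ∀ (R : Type u) [CommRing R] (hR : (p : R) ^ a = 0)
        (P Q : Displays.Display p R ⟨a, hR⟩),
        P.IsNilpotentOfOrderLE e → Q.IsNilpotentOfOrderLE e → P.HasCodim c →
        ∀ f : Displays.Window.Hom P Q,
          f.DivisibleBy p ↔ (Displays.Display.truncMor f n).DivisibleBy p := by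
  -- The length `e + 1` includes the factor that absorbs `ε`. Closeness to the approximate quotient
  -- is no longer needed, so `m = 0`.
  obtain ⟨n, hn0, hn⟩ := exists_divided_solution.{u} p a (e + 1) 0
  refine ⟨n, hn0, fun R _ hR P Q hP _ _ f => ⟨?_, ?_⟩⟩
  · rintro ⟨g, hg⟩
    refine ⟨Display.truncMor g n, ?_⟩
    change f.toHom.baseChange _ = p • g.toHom.baseChange _
    rw [hg, FilMod.Hom.baseChange_nsmul]
  · rintro ⟨g, hg⟩
    -- The lift `h` is compatible with `Ψ` only after truncation.
    obtain ⟨h, hhg⟩ := FilMod.Hom.exists_baseChange_eq (P := P.toFilMod) (Q := Q.toFilMod)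
      (truncHom p R n ⟨a, hR⟩) (truncHom_onA_surjective n _) (truncHom_onI_surjective n _) g.toHom
    have hfh : f.toHom.baseChange (truncHom p R n ⟨a, hR⟩) =
        (p • h).baseChange (truncHom p R n ⟨a, hR⟩) := by
      rw [FilMod.Hom.baseChange_nsmul, hhg]
      exact hg
    obtain ⟨k, l, ⟨b⟩⟩ := FilMod.Gens.exists_gens P.toFilMod
    obtain ⟨k', l', ⟨b'⟩⟩ := FilMod.Gens.exists_gens Q.toFilMod
    have hd := Display.defect_mem_of_comm b b' n (f := h) (by rw [hhg]; exact g.comm)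
    have hU := Display.homMat_sub_mem b b' n hfh
    have hB := Display.divMat_sub_mem b b' n hfh
    rw [Display.homMat_nsmul b b' p h] at hU
    rw [Display.divMat_nsmul b b' p h] at hB
    obtain ⟨U', B', hs, hU', -⟩ := hn R (by rw [pow_succ, hR, zero_mul]) _ _ _
      (matSystem_frobProd_coeff_zero _ _ (e + 1) (hP.frobProd_coeff_zero b)) _ _ _ _
      ((Display.comm_iff_isSol b b' f.toHom).mp f.comm) hd.1 hd.2 hU hB
    obtain ⟨g', hg'⟩ := Display.exists_hom_of_isSol b b'
      (U := Matrix.of fun i j => U' (i, j)) (B := Matrix.of fun i j => B' (i, j)) hs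
    refine ⟨g', Display.homMat_injective b b' ?_⟩
    rw [Display.homMat_nsmul b b' p g'.toHom, hg']
    ext i j : 1
    exact congrFun hU' (i, j)
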